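/- **Model.** There are $n\ge 2$ parties, at most $f$ of which are Byzantine (they behave arbitrarily); the other parties are honest and run a deterministic protocol without signatures, over authenticated reliable point-to-point channels. In an execution with actual delay bound $\delta$, every message between honest parties is delivered after a positive time of at most $\delta$, and honest parties start their (drift-free) local clocks at most $\delta$ apart. The number $\Delta>0$ is a known bound with $0<\delta\le\Delta$ for all executions; $\delta$ is not known to the parties. Every party sends and receives only finitely many messages in bounded time. A protocol *solves Byzantine broadcast* with designated broadcaster $L$ (who alone has an input) if in all executions (agreement) honest parties never commit different values, (validity) if $L$ is honest, all honest parties commit its input and terminate, (termination) all honest parties commit and terminate; a default value $\bot$ may be committed if $L$ is Byzantine. Its *good-case latency* is at most $T(\delta)$ if, in every execution with actual delay bound $\delta$ in which $L$ is honest, all honest parties commit within time $T(\delta)$ since $L$ starts. *Byzantine agreement* is defined likewise, with an input for each party and with the validity condition that the common input is committed if all honest inputs are equal. **Protocol.** Let $\sigma=\Delta$, let $\mathcal B$ be any protocol that solves Byzantine agreement in this model (on the values of the broadcast and $\bot$, for these $n,f,\Delta$), and initially let $\mathtt{lock}=\bot$ at each party. 1. *Propose.* $L$ with input $v$ sends $\langle\mathtt{propose},v\rangle$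 to all parties. 2. *Ack.* On receiving the first proposal $\langle\mathtt{propose},v\rangle$ from $L$, a party sends $\langle\mathtt{ack},v\rangle$ to all parties. 3. *Commit.* On receiving $\langle\mathtt{ack},v\rangle$ from $n-f-1$ distinct non-broadcaster parties at local time $t$, a party sets $\mathtt{lock}=v$; if $t\le 2\Delta+\sigma$, it commits $v$. 4. *Vote.* On receiving $\langle\mathtt{ack},v\rangle$ from $n-2f$ distinct non-broadcaster parties, a party sets $\mathtt{lock}=v$ and, if it has not yet sent a vote, sends $\langle\mathtt{vote},v\rangle$ to all parties. On receiving $\langle\mathtt{vote},v\rangle$ from $n-f-1$ distinct non-broadcaster parties, it sets $\mathtt{lock}=v$. 5. *Byzantine agreement.* At local time $3\Delta+2\sigma$ a party invokes $\mathcal B$ with input $\mathtt{lock}$. If it has not committed in step 3, it commits the output of $\mathcal B$. It terminates when $\mathcal B$ does. (Ties between events at the same local time are resolved by an arbitrary fixed rule of each party.) **Theorem 9.** Let the set of broadcast values have at least two elements. 1. If $n\ge 4f$, the protocol above solves Byzantine broadcast, and its good-case latency is at most $2\delta$. 2. The latency is optimal: if $n\ge 4f$ and $f\ge 1$, then every protocol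 that solves Byzantine broadcast with good-case latency at most $T(\delta)$ satisfies $T(\delta)\ge 2\delta$ for all $0<\delta\le\Delta$. 3. The resilience is optimal: if $3\le n'<4f$, then every protocol for $n'$ parties, at most $f$ of them Byzantine, that solves Byzantine broadcast with good-case latency at most $T(\delta)$ satisfies $T(\delta)>2\delta$ for all $0<\delta\le\Delta$; in particular, no such protocol has good-case latency $2\delta$. -/

import Mathlib

/-!
Deterministic unauthenticated protocols for `n` parties under synchrony, with local clocks,
an execution model with Byzantine parties, Byzantine broadcast and Byzantine agreement,
the good-case latency, and the ack/vote broadcast protocol that ends with a Byzantine agreement.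
-/

universe u v w

namespace SyncBB

/-- What a party has received: triples (local receiving time, sender, message). -/
abbrev History (n : ℕ) (M : Type w) := Set (ℝ × Fin n × M)

/-- The part of a history received up to (and including) local time `t`. -/
def upTo {n : ℕ} {M : Type w} (h : History n M) (t : ℝ) : History n M := {e ∈ h | e.1 ≤ t}

/-- Only finitely many messages are received in bounded time. -/
def LocallyFinite {n : ℕ} {M : Type w} (h : History n M) : Prop := ∀ T : ℝ, (upTo h T).Finite

/-- A deterministic protocol for `n` parties with inputs in `I`, outputs in `O` and messages in `M`.
What a party does at local time `t ≥ 0` is a function of its identity, its input, and the messages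
received so far with their local receiving times: `send p x h t d` is the set of messages it sends
to `d` at local time `t`, `commit p x h t` the set of values that it commits at local time `t`
(committing the same value repeatedly has no effect), and `halt p x h t` says that it terminates at
local time `t` (or has terminated before). -/
structure Protocol (n : ℕ) (I : Type u) (O : Type v) (M : Type w) where
  send : Fin n → I → History n M → ℝ → Fin n → Set M
  commit : Fin n → I → History n M → ℝ → Set O
  halt : Fin n → I → History n M → ℝ → Prop
  /-- A party sends only finitely many messages in bounded time. -/
  finite_send : ∀ (p : Fin n) (x : I) (h : History n M), LocallyFinite h → ∀ T : ℝ,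
    {e : ℝ × Fin n × M | 0 ≤ e.1 ∧ e.1 ≤ T ∧ e.2.2 ∈ send p x (upTo h e.1) e.1 e.2.1}.Finite

/-- The data of an execution. Times are global (real) times. The party `p` starts at time `start p`,
and `(r, q, m) ∈ recv p` says that `p` receives the message `m` from the party `q` at time `r`.
The entries `start p`, `input p`, `recv p` matter only for honest `p`. -/
structure Run (n : ℕ) (I : Type u) (M : Type w) where
  honest : Finset (Fin n)
  start : Fin n → ℝ
  input : Fin n → I
  recv : Fin n → Set (ℝ × Fin n × M)

namespace Run

variable {n : ℕ} {I : Type u} {O : Type v} {M : Type w}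

/-- The history of `p` by its local clock, which starts at `0` at time `start p`. A message that
arrives before `p` starts is handled by `p` when it starts. -/
def localHist (e : Run n I M) (p : Fin n) : History n M :=
  {a | ∃ r : ℝ, (r, a.2.1, a.2.2) ∈ e.recv p ∧ a.1 = max 0 (r - e.start p)}

/-- `p` has started and has not terminated before local time `t`. -/
def Active (e : Run n I M) (P : Protocol n I O M) (p : Fin n) (t : ℝ) : Prop :=
  0 ≤ t ∧ ∀ s : ℝ, 0 ≤ s → s < t → ¬ P.halt p (e.input p) (upTo (e.localHist p) s) s

/-- Following the protocol, `p` sends `m` to `d` at the global time `r`. -/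
def Sends (e : Run n I M) (P : Protocol n I O M) (p : Fin n) (r : ℝ) (d : Fin n) (m : M) : Prop :=
  e.Active P p (r - e.start p) ∧
    m ∈ P.send p (e.input p) (upTo (e.localHist p) (r - e.start p)) (r - e.start p) d

/-- Following the protocol, `p` commits the value `o` at the global time `r`. -/
def CommitsAt (e : Run n I M) (P : Protocol n I O M) (p : Fin n) (r : ℝ) (o : O) : Prop :=
  e.Active P p (r - e.start p) ∧
    o ∈ P.commit p (e.input p) (upTo (e.localHist p) (r - e.start p)) (r - e.start p)

/-- `p` commits the value `o` at some time. -/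
def Commits (e : Run n I M) (P : Protocol n I O M) (p : Fin n) (o : O) : Prop :=
  ∃ r : ℝ, e.CommitsAt P p r o

/-- `p` has terminated at some time, and has committed some value by then. -/
def CommitsAndTerminates (e : Run n I M) (P : Protocol n I O M) (p : Fin n) : Prop :=
  ∃ t : ℝ, 0 ≤ t ∧ P.halt p (e.input p) (upTo (e.localHist p) t) t ∧
    ∃ r : ℝ, r ≤ e.start p + t ∧ ∃ o : O, e.CommitsAt P p r o

end Run

/-- `e` is an execution of `P` with at most `f` Byzantine parties in which the message delays between
honest parties, and the differences between the starting times of honest parties, are at most `δ`.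
Every message between honest parties is delivered exactly once, unmodified, after a positive
delay of at most `δ`; honest parties receive nothing in the name of an honest party that this
party did not send; the messages that come from Byzantine parties are arbitrary. -/
structure IsExecution {n : ℕ} {I : Type u} {O : Type v} {M : Type w}
    (P : Protocol n I O M) (f : ℕ) (δ : ℝ) (e : Run n I M) : Prop where
  byzantine : (e.honestᶜ).card ≤ f
  skew : ∀ p ∈ e.honest, ∀ q ∈ e.honest, |e.start p - e.start q| ≤ δ
  finite_recv : ∀ p ∈ e.honest, ∀ T : ℝ, {a ∈ e.recv p | a.1 ≤ T}.Finite
  delivery : ∃ delay : Fin n → Fin n → ℝ → M → ℝ,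
    (∀ q p s m, 0 < delay q p s m ∧ delay q p s m ≤ δ) ∧
    ∀ q ∈ e.honest, ∀ p ∈ e.honest, ∀ (r : ℝ) (m : M),
      (r, q, m) ∈ e.recv p ↔ ∃ s : ℝ, e.Sends P q s p m ∧ r = s + delay q p s m

/-- In a broadcast with broadcaster `L`, exactly the broadcaster has an input value. -/
def BroadcastInput {n : ℕ} {V : Type u} {M : Type w} (L : Fin n) (e : Run n (Option V) M) : Prop :=
  ∀ p ∈ e.honest, (e.input p).isSome ↔ p = L

/-- `P` solves Byzantine broadcast of values in `V` with broadcaster `L`, in the presence of at most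
`f` Byzantine parties, when `Δ` bounds the delays of all executions. The value `none` is the default
value `⊥`, which may be committed if the broadcaster is Byzantine. -/
structure SolvesBB {n : ℕ} {V : Type u} {M : Type w}
    (P : Protocol n (Option V) (Option V) M) (L : Fin n) (f : ℕ) (Δ : ℝ) : Prop where
  agreement : ∀ (δ : ℝ) (e : Run n (Option V) M), 0 < δ → δ ≤ Δ → IsExecution P f δ e →
    BroadcastInput L e → ∀ p ∈ e.honest, ∀ q ∈ e.honest, ∀ o o' : Option V,
      e.Commits P p o → e.Commits P q o' → o = o'
  validity : ∀ (δ : ℝ) (e : Run n (Option V) M), 0 < δ → δ ≤ Δ → IsExecution P f δ e →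
    BroadcastInput L e → L ∈ e.honest → ∀ x : V, e.input L = some x →
      ∀ p ∈ e.honest, e.Commits P p (some x) ∧ e.CommitsAndTerminates P p
  termination : ∀ (δ : ℝ) (e : Run n (Option V) M), 0 < δ → δ ≤ Δ → IsExecution P f δ e →
    BroadcastInput L e → ∀ p ∈ e.honest, e.CommitsAndTerminates P p

/-- `P` solves Byzantine agreement on values in `X`: every party has an input, honest parties agree,
commit and terminate, and they commit the common input if all honest inputs are equal. -/
structure SolvesBA {n : ℕ} {X : Type u} {M : Type w}
    (P : Protocol n X X M) (f : ℕ) (Δ : ℝ) : Prop where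
  agreement : ∀ (δ : ℝ) (e : Run n X M), 0 < δ → δ ≤ Δ → IsExecution P f δ e →
    ∀ p ∈ e.honest, ∀ q ∈ e.honest, ∀ o o' : X, e.Commits P p o → e.Commits P q o' → o = o'
  validity : ∀ (δ : ℝ) (e : Run n X M), 0 < δ → δ ≤ Δ → IsExecution P f δ e →
    ∀ x : X, (∀ p ∈ e.honest, e.input p = x) → ∀ p ∈ e.honest, e.Commits P p x
  termination : ∀ (δ : ℝ) (e : Run n X M), 0 < δ → δ ≤ Δ → IsExecution P f δ e →
    ∀ p ∈ e.honest, e.CommitsAndTerminates P p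

/-- The good-case latency of the broadcast protocol `P` is at most `T δ`, where `δ` is the actual
delay bound of the execution: if the broadcaster is honest, then all honest parties commit within
time `T δ` since the broadcaster starts. -/
def GoodCaseLatency {n : ℕ} {V : Type u} {M : Type w}
    (P : Protocol n (Option V) (Option V) M) (L : Fin n) (f : ℕ) (Δ : ℝ) (T : ℝ → ℝ) : Prop :=
  ∀ (δ : ℝ) (e : Run n (Option V) M), 0 < δ → δ ≤ Δ → IsExecution P f δ e →
    BroadcastInput L e → L ∈ e.honest →
      ∀ p ∈ e.honest, ∃ r : ℝ, r ≤ e.start L + T δ ∧ ∃ o : Option V, e.CommitsAt P p r o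

/-! ### The protocol -/

/-- Messages of the protocol; `ba m` is a message `m` of the Byzantine agreement at the end. -/
inductive Msg (V : Type u) (M : Type w) : Type (max u w)
  | propose (x : V)
  | ack (x : V)
  | vote (x : V)
  | ba (m : M)

/-- `t` is the first time at which `Q` holds. -/
def FirstTime (Q : ℝ → Prop) (t : ℝ) : Prop := Q t ∧ ∀ s : ℝ, s < t → ¬ Q s

section Rules

variable {n : ℕ} {V : Type u} {M : Type w}

/-- By local time `t`, the message `m` was received from `k` distinct non-broadcaster parties. -/
def Quorum (L : Fin n) (k : ℕ) (h : History n (Msg V M)) (m : Msg V M) (t : ℝ) : Prop :=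
  k ≤ {q : Fin n | q ≠ L ∧ ∃ s : ℝ, s ≤ t ∧ (s, q, m) ∈ h}.ncard

/-- The first proposal from the broadcaster is received at local time `t`. If several proposals
arrive at that time, `pick` decides which of them counts as the first. -/
def AcksAt (L : Fin n) (pick : Set V → V) (h : History n (Msg V M)) (t : ℝ) (x : V) : Prop :=
  FirstTime (fun s => ∃ y : V, ∃ s' : ℝ, s' ≤ s ∧ (s', L, Msg.propose y) ∈ h) t ∧
    x = pick {y : V | (t, L, Msg.propose y) ∈ h}

/-- The party votes for `x` at local time `t`: this is the first time that it has `n - 2f` acks for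
some value (`pick` decides if this happens for several values at the same time). -/
def VotesAt (L : Fin n) (f : ℕ) (pick : Set V → V) (h : History n (Msg V M)) (t : ℝ) (x : V) :
    Prop :=
  FirstTime (fun s => ∃ y : V, Quorum L (n - 2 * f) h (.ack y) s) t ∧
    x = pick {y : V | Quorum L (n - 2 * f) h (.ack y) t}

/-- The party assigns `x` to its lock at local time `t`: at this time it gets the
`(n - f - 1)`-th ack, the `(n - 2f)`-th ack, or the `(n - f - 1)`-th vote for `x`
from distinct non-broadcaster parties. -/
def SetsLockAt (L : Fin n) (f : ℕ) (h : History n (Msg V M)) (t : ℝ) (x : V) : Prop :=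
  FirstTime (Quorum L (n - f - 1) h (.ack x)) t ∨
  FirstTime (Quorum L (n - 2 * f) h (.ack x)) t ∨
  FirstTime (Quorum L (n - f - 1) h (.vote x)) t

open Classical in
/-- The lock at local time `T`: `⊥` if it was never assigned, and otherwise the value assigned last
(`pick` decides if several values are assigned at the same time). -/
noncomputable def lock (L : Fin n) (f : ℕ) (pick : Set V → V) (h : History n (Msg V M)) (T : ℝ) :
    Option V :=
  if ∃ (x : V) (t : ℝ), t ≤ T ∧ SetsLockAt L f h t x then
    some (pick {x : V | ∃ t : ℝ, t ≤ T ∧ SetsLockAt L f h t x ∧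
      ∀ (y : V) (s : ℝ), s ≤ T → SetsLockAt L f h s y → s ≤ t})
  else none

/-- The messages of the Byzantine agreement that is invoked at local time `T`, in terms of its own
local clock, which starts at `0` when it is invoked. -/
def baHist (h : History n (Msg V M)) (T : ℝ) : History n M :=
  {a | ∃ s : ℝ, (s, a.2.1, Msg.ba a.2.2) ∈ h ∧ a.1 = max 0 (s - T)}

/-- The set of messages that `p` sends to `d` at local time `t`, with the Byzantine agreement `B`
invoked at local time `T` with the lock as input. -/
def sendRule (L : Fin n) (f : ℕ) (T : ℝ) (pick : Set V → V)
    (B : Protocol n (Option V) (Option V) M) (p : Fin n) (x : Option V)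
    (h : History n (Msg V M)) (t : ℝ) (d : Fin n) : Msg V M → Prop
  | .propose y => p = L ∧ t = 0 ∧ x = some y
  | .ack y => AcksAt L pick h t y
  | .vote y => VotesAt L f pick h t y
  | .ba m => T ≤ t ∧ m ∈ B.send p (lock L f pick h T) (baHist h T) (t - T) d

end Rules

section FinitelyManyMessages

variable {n : ℕ} {V : Type u} {M : Type w}

theorem quorum_upTo (L : Fin n) (k : ℕ) (h : History n (Msg V M)) (m : Msg V M) {s t : ℝ}
    (hst : s ≤ t) : Quorum L k (upTo h t) m s ↔ Quorum L k h m s := by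
  have : {q : Fin n | q ≠ L ∧ ∃ s' : ℝ, s' ≤ s ∧ (s', q, m) ∈ upTo h t} =
      {q : Fin n | q ≠ L ∧ ∃ s' : ℝ, s' ≤ s ∧ (s', q, m) ∈ h} := by
    ext q
    constructor
    · rintro ⟨hq, s', hs', hm⟩
      exact ⟨hq, s', hs', hm.1⟩
    · rintro ⟨hq, s', hs', hm⟩
      exact ⟨hq, s', hs', hm, hs'.trans hst⟩
  unfold Quorum
  rw [this]

theorem firstTime_upTo {Q : History n (Msg V M) → ℝ → Prop} {h : History n (Msg V M)}
    (hQ : ∀ s t : ℝ, s ≤ t → (Q (upTo h t) s ↔ Q h s)) {t : ℝ} :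
    FirstTime (Q (upTo h t)) t ↔ FirstTime (Q h) t := by
  unfold FirstTime
  rw [hQ t t le_rfl]
  refine and_congr_right fun _ => forall_congr' fun s => forall_congr' fun hs => ?_
  rw [hQ s t hs.le]

theorem FirstTime.unique {Q : ℝ → Prop} {s t : ℝ} (hs : FirstTime Q s) (ht : FirstTime Q t) :
    s = t := by
  rcases lt_trichotomy s t with h | h | h
  · exact absurd hs.1 (ht.2 s h)
  · exact h
  · exact absurd ht.1 (hs.2 t h)

theorem lock_upTo (L : Fin n) (f : ℕ) (pick : Set V → V) (h : History n (Msg V M)) {T t : ℝ}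
    (hT : T ≤ t) : lock L f pick (upTo h t) T = lock L f pick h T := by
  have key : ∀ (s : ℝ) (x : V), s ≤ T →
      (SetsLockAt L f (upTo h t) s x ↔ SetsLockAt L f h s x) := by
    intro s x hs
    have aux : ∀ (k : ℕ) (m : Msg V M),
        FirstTime (Quorum L k (upTo h t) m) s ↔ FirstTime (Quorum L k h m) s := by
      intro k m
      unfold FirstTime
      rw [quorum_upTo L k h m (hs.trans hT)]
      refine and_congr_right fun _ => forall_congr' fun r => forall_congr' fun hr => ?_
      rw [quorum_upTo L k h m (hr.le.trans (hs.trans hT))]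
    unfold SetsLockAt
    rw [aux, aux, aux]
  unfold lock
  have h1 : (∃ (x : V) (s : ℝ), s ≤ T ∧ SetsLockAt L f (upTo h t) s x) ↔
      ∃ (x : V) (s : ℝ), s ≤ T ∧ SetsLockAt L f h s x :=
    exists_congr fun x => exists_congr fun s => and_congr_right fun hs => key s x hs
  have h2 : {x : V | ∃ s : ℝ, s ≤ T ∧ SetsLockAt L f (upTo h t) s x ∧
        ∀ (y : V) (r : ℝ), r ≤ T → SetsLockAt L f (upTo h t) r y → r ≤ s} =
      {x : V | ∃ s : ℝ, s ≤ T ∧ SetsLockAt L f h s x ∧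
        ∀ (y : V) (r : ℝ), r ≤ T → SetsLockAt L f h r y → r ≤ s} := by
    ext x
    refine exists_congr fun s => and_congr_right fun hs => and_congr (key s x hs) ?_
    refine forall_congr' fun y => forall_congr' fun r => forall_congr' fun hr => ?_
    rw [key r y hr]
  rw [h2]
  by_cases hc : ∃ (x : V) (s : ℝ), s ≤ T ∧ SetsLockAt L f h s x
  · rw [if_pos hc, if_pos (h1.2 hc)]
  · rw [if_neg hc, if_neg (fun H => hc (h1.1 H))]

theorem baHist_upTo (h : History n (Msg V M)) {T t : ℝ} (hT : T ≤ t) :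
    baHist (upTo h t) T = upTo (baHist h T) (t - T) := by
  ext ⟨s, q, m⟩
  constructor
  · rintro ⟨r, ⟨hr, hrt⟩, hs⟩
    simp only at hr hrt hs
    refine ⟨⟨r, hr, hs⟩, ?_⟩
    simp only [hs]
    exact max_le (by linarith) (by linarith)
  · rintro ⟨⟨r, hr, hs⟩, hst⟩
    simp only at hr hs hst
    refine ⟨r, ⟨hr, ?_⟩, hs⟩
    have := le_max_right 0 (r - T)
    simp only
    linarith

theorem baHist_locallyFinite {h : History n (Msg V M)} (hh : LocallyFinite h) (T : ℝ) :
    LocallyFinite (baHist h T) := by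
  intro S
  have hinj : Function.Injective
      (fun a : ℝ × Fin n × M => ((a.1, a.2.1, Msg.ba a.2.2) : ℝ × Fin n × Msg V M)) := by
    rintro ⟨a, b, c⟩ ⟨a', b', c'⟩ hab
    simpa using hab
  have hf := ((hh (S + T)).preimage (hinj.injOn (s := _))).image
    (fun a : ℝ × Fin n × M => ((max 0 (a.1 - T), a.2) : ℝ × Fin n × M))
  refine hf.subset ?_
  rintro ⟨s, q, m⟩ ⟨⟨r, hr, hs⟩, hst⟩
  simp only at hr hs hst
  refine ⟨(r, q, m), ⟨hr, ?_⟩, by simp [hs]⟩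
  have := le_max_right 0 (r - T)
  simp only
  linarith

theorem sendRule_finite (L : Fin n) (f : ℕ) (T : ℝ) (pick : Set V → V)
    (B : Protocol n (Option V) (Option V) M) (p : Fin n) (x : Option V)
    (h : History n (Msg V M)) (hh : LocallyFinite h) (S : ℝ) :
    {e : ℝ × Fin n × Msg V M | 0 ≤ e.1 ∧ e.1 ≤ S ∧
      e.2.2 ∈ {m | sendRule L f T pick B p x (upTo h e.1) e.1 e.2.1 m}}.Finite := by
  have once : ∀ R : Set (ℝ × Msg V M), R.Subsingleton →
      {e : ℝ × Fin n × Msg V M | (e.1, e.2.2) ∈ R}.Finite := by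
    intro R hR
    have := ((hR.finite).prod (Set.finite_univ (α := Fin n))).image
      (fun a : (ℝ × Msg V M) × Fin n => (a.1.1, a.2, a.1.2))
    refine this.subset ?_
    rintro ⟨t, d, m⟩ ht
    exact ⟨((t, m), d), ⟨ht, Set.mem_univ _⟩, rfl⟩
  have f1 := once {a | ∃ y : V, a.1 = 0 ∧ x = some y ∧ a.2 = .propose y} (by
    rintro ⟨t, m⟩ ⟨y, h1, h2, h3⟩ ⟨t', m'⟩ ⟨y', h1', h2', h3'⟩
    simp only at h1 h3 h1' h3'
    have : y = y' := by rw [h2] at h2'; exact Option.some.inj h2'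
    subst this
    rw [h1, h3, h1', h3'])
  have f2 := once {a | ∃ y : V, AcksAt L pick (upTo h a.1) a.1 y ∧ a.2 = .ack y} (by
    rintro ⟨t, m⟩ ⟨y, ⟨h1, h2⟩, h3⟩ ⟨t', m'⟩ ⟨y', ⟨h1', h2'⟩, h3'⟩
    simp only at h1 h2 h3 h1' h2' h3'
    have hQ : ∀ s t : ℝ, s ≤ t →
        ((∃ y : V, ∃ s' : ℝ, s' ≤ s ∧ (s', L, Msg.propose y) ∈ upTo h t) ↔
          ∃ y : V, ∃ s' : ℝ, s' ≤ s ∧ (s', L, Msg.propose y) ∈ h) := fun s t hst =>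
      exists_congr fun y => exists_congr fun s' => and_congr_right fun hs' =>
        ⟨fun H => H.1, fun H => ⟨H, hs'.trans hst⟩⟩
    have e1 := (firstTime_upTo (Q := fun h s => ∃ y : V, ∃ s' : ℝ, s' ≤ s ∧
      (s', L, Msg.propose y) ∈ h) hQ).1 h1
    have e2 := (firstTime_upTo (Q := fun h s => ∃ y : V, ∃ s' : ℝ, s' ≤ s ∧
      (s', L, Msg.propose y) ∈ h) hQ).1 h1'
    have := e1.unique e2
    subst this
    rw [h3, h3', h2, h2'])
  have f3 := once {a | ∃ y : V, VotesAt L f pick (upTo h a.1) a.1 y ∧ a.2 = .vote y} (by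
    rintro ⟨t, m⟩ ⟨y, ⟨h1, h2⟩, h3⟩ ⟨t', m'⟩ ⟨y', ⟨h1', h2'⟩, h3'⟩
    simp only at h1 h2 h3 h1' h2' h3'
    have hQ : ∀ s t : ℝ, s ≤ t →
        ((∃ y : V, Quorum L (n - 2 * f) (upTo h t) (.ack y) s) ↔
          ∃ y : V, Quorum L (n - 2 * f) h (.ack y) s) := fun s t hst =>
      exists_congr fun y => quorum_upTo L _ h _ hst
    have e1 := (firstTime_upTo (Q := fun h s => ∃ y : V, Quorum L (n - 2 * f) h (.ack y) s) hQ).1 h1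
    have e2 := (firstTime_upTo
      (Q := fun h s => ∃ y : V, Quorum L (n - 2 * f) h (.ack y) s) hQ).1 h1'
    have := e1.unique e2
    subst this
    rw [h3, h3', h2, h2'])
  have f4 := (B.finite_send p (lock L f pick h T) (baHist h T) (baHist_locallyFinite hh T)
    (S - T)).image (fun a : ℝ × Fin n × M =>
      ((a.1 + T, a.2.1, Msg.ba a.2.2) : ℝ × Fin n × Msg V M))
  refine (((f1.union f2).union f3).union f4).subset ?_
  rintro ⟨t, d, m⟩ ⟨h0, h1, h2⟩
  change sendRule L f T pick B p x (upTo h t) t d m at h2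
  simp only at h0 h1
  cases m with
  | propose y => exact .inl (.inl (.inl ⟨y, h2.2.1, h2.2.2, rfl⟩))
  | ack y => exact .inl (.inl (.inr ⟨y, h2, rfl⟩))
  | vote y => exact .inl (.inr ⟨y, h2, rfl⟩)
  | ba m =>
    obtain ⟨hT, hm⟩ := h2
    rw [lock_upTo L f pick h hT, baHist_upTo h hT] at hm
    refine .inr ⟨(t - T, d, m), ⟨by simpa using hT, by simpa using h1, hm⟩, by simp⟩

end FinitelyManyMessages

/-- The broadcast protocol with broadcaster `L`, with the Byzantine agreement `B` as a primitive.
The parameter for the clock skew is `σ`; the lock is the input of `B`, which is invoked at local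
time `3Δ + 2σ`. A party commits `x` if it has `n - f - 1` acks for `x` at local time `≤ 2Δ + σ`;
a party that has not committed in this way commits the output of `B`; a party
terminates when `B` terminates. The rule `pick p` is used by `p` only to decide about events that
happen at the same local time. -/
def broadcast {n : ℕ} {V : Type u} {M : Type w} (L : Fin n) (f : ℕ) (Δ σ : ℝ)
    (pick : Fin n → Set V → V) (B : Protocol n (Option V) (Option V) M) :
    Protocol n (Option V) (Option V) (Msg V M) where
  send p x h t d := {m | sendRule L f (3 * Δ + 2 * σ) (pick p) B p x h t d m}
  commit p _ h t :=
    {o | (t ≤ 2 * Δ + σ ∧ ∃ y : V, o = some y ∧ Quorum L (n - f - 1) h (.ack y) t) ∨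
      (3 * Δ + 2 * σ ≤ t ∧ (¬ ∃ y : V, Quorum L (n - f - 1) h (.ack y) (2 * Δ + σ)) ∧
        o ∈ B.commit p (lock L f (pick p) h (3 * Δ + 2 * σ)) (baHist h (3 * Δ + 2 * σ))
          (t - (3 * Δ + 2 * σ)))}
  halt p _ h t :=
    3 * Δ + 2 * σ ≤ t ∧
      B.halt p (lock L f (pick p) h (3 * Δ + 2 * σ)) (baHist h (3 * Δ + 2 * σ))
        (t - (3 * Δ + 2 * σ))
  finite_send p x h hh T := sendRule_finite L f (3 * Δ + 2 * σ) (pick p) B p x h hh T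

end SyncBB

/-! Upper bound. With an honest broadcaster, every honest party acks its input, so each holds `n - f
- 1` acks at most `2δ` after the broadcaster starts, early enough to commit. With a Byzantine
broadcaster, at most `f - 1` of the acks behind an early commit of `x` are Byzantine, so at least `n
- 2f` honest parties acked `x`. Their acks reach everybody by the time the agreement is invoked. The
at most `2f - 1` other non-broadcasters are too few for `n - 2f` acks on another value because `n ≥
4f`, so no honest party votes for another value either. Hence all honest parties enter the agreement
with lock `x` (`IsExecution.lock_eq_of_quorum`), and its validity forces `x`. Votes are never needed
to set the lock; it suffices that they cannot spoil it. The properties of the inner agreement apply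
because its part of the run is itself an execution (`IsExecution.agreementRun`).

Lower bounds. The protocol runs on a network with several copies of each party, all delays `δ`, and
wiring `src` (`exists_isNetwork`). Choosing one copy of each honest party so that the chosen copies
hear one another gives an execution; the Byzantine parties simulate the rest
(`IsNetwork.isExecution`). Copies that agree along chains of `k` messages behave alike before time
`(k + 1)δ` (`Indistinguishable.sameUntil`). Below `2δ`, a two-faced broadcaster makes two honest
parties commit different values. For `4 ≤ n < 4f` and latency below `3δ`, two good cases are glued
to a third world where two parties commit different values; they are never honest together, but a
third party has to agree with each of them. For three parties broadcast is impossible altogether. -/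

namespace SyncBB

/-! ### Runs that look alike to one party -/

section Congruence

variable {n : ℕ} {I : Type u} {O : Type v} {M : Type w} {P : Protocol n I O M}
  {e e' : Run n I M} {p : Fin n} {r : ℝ}

/-- At `p`, the runs `e` and `e'` look the same up to the global time `r`. -/
structure Run.SameUntil (e e' : Run n I M) (p : Fin n) (r : ℝ) : Prop where
  start : e.start p = e'.start p
  input : e.input p = e'.input p
  recv : ∀ s q m, s ≤ r → ((s, q, m) ∈ e.recv p ↔ (s, q, m) ∈ e'.recv p)

theorem Run.SameUntil.upTo_localHist (h : e.SameUntil e' p r) {t : ℝ} (ht : t ≤ r - e.start p) :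
    upTo (e.localHist p) t = upTo (e'.localHist p) t := by
  ext ⟨s, q, m⟩
  constructor
  · rintro ⟨⟨s', hs', hs⟩, hst⟩
    simp only at hs' hs hst
    have := le_max_right 0 (s' - e.start p)
    exact ⟨⟨s', (h.recv _ _ _ (by linarith)).1 hs', by rw [← h.start]; exact hs⟩, hst⟩
  · rintro ⟨⟨s', hs', hs⟩, hst⟩
    simp only at hs' hs hst
    rw [← h.start] at hs
    have := le_max_right 0 (s' - e.start p)
    exact ⟨⟨s', (h.recv _ _ _ (by linarith)).2 hs', hs⟩, hst⟩

theorem Run.SameUntil.symm (h : e.SameUntil e' p r) : e'.SameUntil e p r :=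
  ⟨h.start.symm, h.input.symm, fun s q m hs => (h.recv s q m hs).symm⟩

theorem Run.SameUntil.mono (h : e.SameUntil e' p r) {s : ℝ} (hs : s ≤ r) : e.SameUntil e' p s :=
  ⟨h.start, h.input, fun s' q m hs' => h.recv s' q m (hs'.trans hs)⟩

theorem Run.SameUntil.active (h : e.SameUntil e' p r) (ha : e.Active P p (r - e.start p)) :
    e'.Active P p (r - e'.start p) := by
  rw [← h.start]
  refine ⟨ha.1, fun s h0 hs => ?_⟩
  rw [← h.input, ← h.upTo_localHist hs.le]
  exact ha.2 s h0 hs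

theorem Run.SameUntil.sends (h : e.SameUntil e' p r) {d : Fin n} {m : M}
    (hm : e.Sends P p r d m) : e'.Sends P p r d m := by
  refine ⟨h.active hm.1, ?_⟩
  rw [← h.start, ← h.input, ← h.upTo_localHist le_rfl]
  exact hm.2

theorem Run.SameUntil.commitsAt (h : e.SameUntil e' p r) {o : O}
    (ho : e.CommitsAt P p r o) : e'.CommitsAt P p r o := by
  refine ⟨h.active ho.1, ?_⟩
  rw [← h.start, ← h.input, ← h.upTo_localHist le_rfl]
  exact ho.2

end Congruence

/-! ### Networks of copies of the parties -/

section Network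

variable {n : ℕ} {I : Type u} {O : Type v} {M : Type w} {ι : Type*}

/-- A network of copies `(i, p)` of the parties `p`, which all start at time `0` and follow `P`.
What `(i, p)` receives in the name of `q` is what the copy `(src i p q, q)` sends to `p`,
with delay `δ`. -/
structure IsNetwork (P : Protocol n I O M) (δ : ℝ) (src : ι → Fin n → Fin n → ι)
    (inp : ι → Fin n → I) (e : ι → Run n I M) : Prop where
  start : ∀ i p, (e i).start p = 0
  input : ∀ i p, (e i).input p = inp i p
  recv : ∀ i p r q m, (r, q, m) ∈ (e i).recv p ↔ (e (src i p q)).Sends P q (r - δ) p m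

/-- The network after `k` rounds of duration `δ`. -/
def networkStage (P : Protocol n I O M) (δ : ℝ) (src : ι → Fin n → Fin n → ι)
    (inp : ι → Fin n → I) : ℕ → ι → Run n I M
  | 0, i => ⟨∅, fun _ => 0, inp i, fun _ => ∅⟩
  | k + 1, i => ⟨∅, fun _ => 0, inp i, fun p =>
      {a | (networkStage P δ src inp k (src i p a.2.1)).Sends P a.2.1 (a.1 - δ) p a.2.2}⟩

variable {P : Protocol n I O M} {δ : ℝ} {src : ι → Fin n → Fin n → ι} {inp : ι → Fin n → I}

theorem networkStage_start (k : ℕ) (i : ι) (p : Fin n) :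
    (networkStage P δ src inp k i).start p = 0 := by
  cases k <;> rfl

theorem networkStage_input (k : ℕ) (i : ι) (p : Fin n) :
    (networkStage P δ src inp k i).input p = inp i p := by
  cases k <;> rfl

/-- What arrives by time `(k + 1)δ` was sent by time `kδ`, so one more round cannot change what
earlier rounds have settled. -/
theorem networkStage_succ (hδ : 0 < δ) (k : ℕ) (i : ι) (p : Fin n) :
    (networkStage P δ src inp k i).SameUntil (networkStage P δ src inp (k + 1) i) p (k * δ) := by
  induction k generalizing i p with
  | zero =>
    refine ⟨rfl, rfl, fun s q m hs => ⟨fun h => h.elim, fun h => ?_⟩⟩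
    have h0 := h.1.1
    rw [networkStage_start] at h0
    simp only at h0
    push_cast at hs
    linarith
  | succ k ih =>
    refine ⟨rfl, rfl, fun s q m hs => ?_⟩
    have hs' : s - δ ≤ k * δ := by push_cast at hs; linarith
    exact ⟨((ih (src i p q) q).mono hs').sends, ((ih (src i p q) q).mono hs').symm.sends⟩

theorem networkStage_le (hδ : 0 < δ) {k j : ℕ} (hkj : k ≤ j) (i : ι) (p : Fin n) :
    (networkStage P δ src inp k i).SameUntil (networkStage P δ src inp j i) p (k * δ) := by
  induction j, hkj using Nat.le_induction with
  | base => exact ⟨rfl, rfl, fun _ _ _ _ => Iff.rfl⟩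
  | succ j hkj ih =>
    have h := (networkStage_succ (P := P) (src := src) (inp := inp) hδ j i p).mono
      (mul_le_mul_of_nonneg_right (Nat.cast_le.2 hkj) hδ.le)
    exact ⟨ih.start.trans h.start, ih.input.trans h.input,
      fun s q m hs => (ih.recv s q m hs).trans (h.recv s q m hs)⟩

/-- The limit of the stages: whether a message arrives at time `r` is read off from stage `⌈r /
δ⌉₊`, where it is already settled. -/
theorem exists_isNetwork (P : Protocol n I O M) (hδ : 0 < δ) (src : ι → Fin n → Fin n → ι)
    (inp : ι → Fin n → I) : ∃ e : ι → Run n I M, IsNetwork P δ src inp e := by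
  let e : ι → Run n I M := fun i => ⟨∅, fun _ => 0, inp i, fun p =>
    {a | a ∈ (networkStage P δ src inp ⌈a.1 / δ⌉₊ i).recv p}⟩
  have key : ∀ (k : ℕ) (i : ι) (p : Fin n),
      (e i).SameUntil (networkStage P δ src inp k i) p (k * δ) := by
    intro k i p
    refine ⟨(networkStage_start k i p).symm, (networkStage_input k i p).symm, fun s q m hs => ?_⟩
    have hk : ⌈s / δ⌉₊ ≤ k := Nat.ceil_le.2 ((div_le_iff₀ hδ).2 hs)
    exact (networkStage_le hδ hk i p).recv s q m ((div_le_iff₀ hδ).1 (Nat.le_ceil _))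
  refine ⟨e, fun _ _ => rfl, fun _ _ => rfl, fun i p r q m => ?_⟩
  have hr : r ≤ ⌈r / δ⌉₊ * δ := (div_le_iff₀ hδ).1 (Nat.le_ceil _)
  have hs := (key ⌈r / δ⌉₊ (src i p q) q).mono (s := r - δ) (by linarith)
  exact ((networkStage_succ hδ _ i p).recv r q m hr).trans ⟨hs.symm.sends, hs.sends⟩

variable {e : ι → Run n I M}

theorem IsNetwork.finite_recv (he : IsNetwork P δ src inp e) (hδ : 0 < δ) (i : ι) (p : Fin n)
    (T : ℝ) : {a ∈ (e i).recv p | a.1 ≤ T}.Finite := by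
  have key : ∀ (k : ℕ) (i : ι) (p : Fin n), {a ∈ (e i).recv p | a.1 ≤ k * δ}.Finite := by
    intro k
    induction k with
    | zero =>
      intro i p
      refine Set.Finite.subset Set.finite_empty ?_
      rintro ⟨r, q, m⟩ ⟨h, hr⟩
      have h0 := ((he.recv i p r q m).1 h).1.1
      rw [he.start] at h0
      simp only [Nat.cast_zero, zero_mul] at hr
      linarith
    | succ k ih =>
      intro i p
      have hfin : ∀ q : Fin n, (upTo ((e (src i p q)).localHist q) (k * δ)).Finite := by
        intro q
        refine ((ih (src i p q) q).image
          (fun a : ℝ × Fin n × M => ((max 0 a.1, a.2) : ℝ × Fin n × M))).subset ?_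
        rintro ⟨s, q', m⟩ ⟨⟨s', h, hs⟩, hst⟩
        simp only at h hs hst
        rw [he.start, sub_zero] at hs
        have := le_max_right 0 s'
        exact ⟨(s', q', m), ⟨h, by simp only; linarith⟩, by rw [hs]⟩
      -- `finite_send` needs a locally finite history. Cutting the sender's history at `kδ` provides
      -- one and, by `hup` below, does not alter what it sends up to then.
      have hsend := fun q : Fin n => (P.finite_send q (inp (src i p q) q) _
        (fun T => (hfin q).subset (Set.sep_subset _ _)) (k * δ)).image
          (fun a : ℝ × Fin n × M => ((a.1 + δ, q, a.2.2) : ℝ × Fin n × M))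
      refine (Set.finite_iUnion hsend).subset ?_
      rintro ⟨r, q, m⟩ ⟨h, hr⟩
      obtain ⟨⟨h0, -⟩, hm⟩ := (he.recv i p r q m).1 h
      simp only [Nat.cast_succ] at hr
      rw [he.start, sub_zero] at h0 hm
      rw [he.input] at hm
      refine Set.mem_iUnion.2 ⟨q, (r - δ, p, m), ⟨h0, by simp only; linarith, ?_⟩, by simp⟩
      have hup : upTo (upTo ((e (src i p q)).localHist q) (k * δ)) (r - δ) =
          upTo ((e (src i p q)).localHist q) (r - δ) := by
        ext a
        exact ⟨fun h => ⟨h.1.1, h.2⟩, fun h => ⟨⟨h.1, h.2.trans (by linarith)⟩, h.2⟩⟩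
      simp only
      rw [hup]
      exact hm
  refine (key ⌈T / δ⌉₊ i p).subset fun a ha => ⟨ha.1, ha.2.trans ?_⟩
  exact (div_le_iff₀ hδ).1 (Nat.le_ceil _)

/-- The run in which the honest parties `p ∈ H` are the copies `(c p, p)` of a network. -/
def networkRun (e : ι → Run n I M) (H : Finset (Fin n)) (c : Fin n → ι) : Run n I M :=
  ⟨H, fun p => (e (c p)).start p, fun p => (e (c p)).input p, fun p => (e (c p)).recv p⟩

/-- Only the wiring between honest parties is constrained: whatever comes from a copy outside the
choice `c` counts as Byzantine and may be arbitrary. -/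
theorem IsNetwork.isExecution (he : IsNetwork P δ src inp e) (hδ : 0 < δ) {f : ℕ}
    {H : Finset (Fin n)} {c : Fin n → ι} (hH : Hᶜ.card ≤ f)
    (hc : ∀ p ∈ H, ∀ q ∈ H, src (c p) p q = c q) :
    IsExecution P f δ (networkRun e H c) where
  byzantine := hH
  skew p _ q _ := by simp [networkRun, he.start, hδ.le]
  finite_recv p _ T := he.finite_recv hδ (c p) p T
  delivery := by
    refine ⟨fun _ _ _ _ => δ, fun _ _ _ _ => ⟨hδ, le_rfl⟩, fun q hq p hp r m => ?_⟩
    refine (he.recv (c p) p r q m).trans ?_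
    rw [hc p hp q hq]
    refine ⟨fun h => ⟨r - δ, h, by ring⟩, ?_⟩
    rintro ⟨s, h, rfl⟩
    rw [add_sub_cancel_right]
    exact h

/-- The copies `(i, p)` and `(j, p)` of a network cannot be told apart by chains of `k`
messages. -/
def Indistinguishable (src : ι → Fin n → Fin n → ι) (inp : ι → Fin n → I) :
    ℕ → ι → ι → Fin n → Prop
  | 0, i, j, p => inp i p = inp j p
  | k + 1, i, j, p => inp i p = inp j p ∧
      ∀ q, Indistinguishable src inp k (src i p q) (src j p q) q

theorem Indistinguishable.refl (k : ℕ) (i : ι) (p : Fin n) :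
    Indistinguishable src inp k i i p := by
  induction k generalizing i p with
  | zero => rfl
  | succ k ih => exact ⟨rfl, fun q => ih _ q⟩

/-- Nothing is sent before time `0` and each hop takes exactly `δ`, so information that needs `k +
1` hops arrives no earlier than `(k + 1)δ`. -/
theorem Indistinguishable.sameUntil (he : IsNetwork P δ src inp e) {k : ℕ} {i j : ι} {p : Fin n}
    (h : Indistinguishable src inp k i j p) {r : ℝ} (hr : r < (k + 1) * δ) :
    (e i).SameUntil (e j) p r := by
  induction k generalizing i j p r with
  | zero =>
    refine ⟨by rw [he.start, he.start], by rw [he.input, he.input]; exact h, fun s q m hs => ?_⟩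
    rw [he.recv, he.recv]
    constructor <;>
    · intro hm
      have h0 := hm.1.1
      rw [he.start] at h0
      simp only [Nat.cast_zero, zero_add, one_mul] at hr
      linarith
  | succ k ih =>
    refine ⟨by rw [he.start, he.start], by rw [he.input, he.input]; exact h.1, fun s q m hs => ?_⟩
    rw [he.recv, he.recv]
    have := ih (h.2 q) (r := s - δ) (by push_cast at hr; linarith)
    exact ⟨this.sends, this.symm.sends⟩

end Network

/-! ### Lower bounds on latency and resilience -/

section LowerBounds

variable {n : ℕ} {V : Type u} {M : Type w} {ι : Type*} {L : Fin n} {f : ℕ} {Δ δ : ℝ}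
  {P : Protocol n (Option V) (Option V) M} {src : ι → Fin n → Fin n → ι} {val : ι → V}
  {e : ι → Run n (Option V) M}

/-- The inputs of a broadcast network in which the copy `(i, L)` of the broadcaster
has the input `val i`. -/
def broadcastInputs (L : Fin n) (val : ι → V) (i : ι) (p : Fin n) : Option V :=
  if p = L then some (val i) else none

theorem IsNetwork.broadcastInput (he : IsNetwork P δ src (broadcastInputs L val) e)
    (H : Finset (Fin n)) (c : Fin n → ι) : BroadcastInput L (networkRun e H c) := by
  intro p _
  simp only [networkRun, he.input, broadcastInputs]
  split_ifs with h <;> simp [h]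

/-- With an honest broadcaster, a copy of an honest party commits within the latency
the input of the broadcaster. -/
theorem IsNetwork.commitsAt_of_latency (he : IsNetwork P δ src (broadcastInputs L val) e)
    (hP : SolvesBB P L f Δ) {T : ℝ → ℝ} (hT : GoodCaseLatency P L f Δ T) (hδ : 0 < δ)
    (hδΔ : δ ≤ Δ) {H : Finset (Fin n)} {i : ι} (hH : Hᶜ.card ≤ f)
    (hc : ∀ p ∈ H, ∀ q ∈ H, src i p q = i) (hL : L ∈ H) {p : Fin n} (hp : p ∈ H) :
    ∃ r : ℝ, r ≤ T δ ∧ (e i).CommitsAt P p r (some (val i)) := by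
  have hx := he.isExecution hδ (c := fun _ => i) hH hc
  have hb := he.broadcastInput H (fun _ => i)
  obtain ⟨r, hr, o, ho⟩ := hT δ _ hδ hδΔ hx hb hL p hp
  obtain ⟨hv, -⟩ := hP.validity δ _ hδ hδΔ hx hb hL (val i)
    (by simp [networkRun, he.input, broadcastInputs]) p hp
  -- Agreement of `p` with itself: the value committed in time is the one that validity promises.
  have := hP.agreement δ _ hδ hδΔ hx hb p hp p hp _ _ ⟨r, ho⟩ hv
  subst this
  refine ⟨r, ?_, ho⟩
  simpa [networkRun, he.start] using hr

/-- Before `2δ` a party knows only what the broadcaster told it and what others sent before hearing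
from anyone, which does not depend on the broadcaster's input. A broadcaster that shows one input to
`a` and another to the rest thus splits them. -/
theorem two_mul_le_latency [Nontrivial V] (hn : 3 ≤ n) (hf : 1 ≤ f) (hP : SolvesBB P L f Δ)
    {T : ℝ → ℝ} (hT : GoodCaseLatency P L f Δ T) (hδ : 0 < δ) (hδΔ : δ ≤ Δ) : 2 * δ ≤ T δ := by
  by_contra! hlt
  obtain ⟨x, y, hxy⟩ := exists_pair_ne V
  obtain ⟨a, ha, b, hb, hab⟩ : ∃ a ∈ ({L}ᶜ : Finset (Fin n)), ∃ b ∈ ({L}ᶜ : Finset (Fin n)),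
      a ≠ b := Finset.one_lt_card.1 (by rw [Finset.card_compl]; simp; omega)
  simp only [Finset.mem_compl, Finset.mem_singleton] at ha hb
  -- `some true` and `some false` are the good cases, `none` is the run of a two-faced broadcaster
  let src : Option Bool → Fin n → Fin n → Option Bool := fun i p q =>
    match i with
    | some i => some i
    | none => if q = L then some (decide (p = a)) else none
  let val : Option Bool → V := fun i => if i = some true then x else y
  obtain ⟨e, he⟩ := exists_isNetwork P hδ src (broadcastInputs L val)
  have hgood : ∀ (i : Bool) (p : Fin n), p ≠ L → i = decide (p = a) →
      (networkRun e {L}ᶜ (fun _ => none)).Commits P p (some (val (some i))) := by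
    intro i p hp hi
    obtain ⟨r, hr, hc⟩ := he.commitsAt_of_latency hP hT hδ hδΔ (H := Finset.univ) (i := some i)
      (by simp) (fun _ _ _ _ => rfl) (Finset.mem_univ _) (Finset.mem_univ p)
    have hind : Indistinguishable src (broadcastInputs L val) 1 (some i) none p := by
      refine ⟨by simp [broadcastInputs, hp], fun q => ?_⟩
      by_cases hq : q = L
      · simp [src, hq, hi, Indistinguishable]
      · simp [Indistinguishable, broadcastInputs, hq]
    exact ⟨r, (hind.sameUntil he (by push_cast; linarith)).commitsAt hc⟩
  have := hP.agreement δ _ hδ hδΔ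
    (he.isExecution hδ (H := {L}ᶜ) (c := fun _ => none) (by simpa using hf)
      (fun p _ q hq => if_neg (by simpa using hq)))
    (he.broadcastInput _ _) a (by simpa [networkRun] using ha) b (by simpa [networkRun] using hb)
    _ _ (hgood true a ha (by simp)) (hgood false b hb (by simp [hab.symm]))
  simp [val] at this
  exact hxy this

/-- The copies form a path: broadcaster, `a`, `b`, second broadcaster. Each edge is an execution in
which the third party is Byzantine. Validity at the two ends fixes different values for `a` and `b`,
and agreement on the middle edge contradicts this. No timing is involved. -/
theorem not_solvesBB_three [Nontrivial V] {L : Fin 3} {P : Protocol 3 (Option V) (Option V) M}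
    (hf : 1 ≤ f) (hΔ : 0 < Δ) : ¬ SolvesBB P L f Δ := by
  intro hP
  obtain ⟨x, y, hxy⟩ := exists_pair_ne V
  obtain ⟨a, ha, b, hb, hab⟩ : ∃ a ∈ ({L}ᶜ : Finset (Fin 3)), ∃ b ∈ ({L}ᶜ : Finset (Fin 3)),
      a ≠ b := Finset.one_lt_card.1 (by rw [Finset.card_compl]; simp)
  simp only [Finset.mem_compl, Finset.mem_singleton] at ha hb
  -- two copies of the broadcaster: `a` listens to one of them, and `b` to the other
  let src : Bool → Fin 3 → Fin 3 → Bool := fun i p q =>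
    if q = L then (if p = L then i else decide (p = a)) else true
  let val : Bool → V := fun i => if i then x else y
  obtain ⟨e, he⟩ := exists_isNetwork P hΔ src (broadcastInputs L val)
  have hgood : ∀ p, p ≠ L → (e true).Commits P p (some (val (decide (p = a)))) := by
    intro p hp
    have hx := he.isExecution (f := f) hΔ (H := {L, p})
      (c := fun q => if q = L then decide (p = a) else true)
      (by rw [Finset.card_compl, Finset.card_pair hp.symm]; simpa using hf) (by
        simp only [Finset.mem_insert, Finset.mem_singleton]
        rintro _ (rfl | rfl) _ (rfl | rfl) <;> simp [src, hp])
    have := (hP.validity Δ _ hΔ le_rfl hx (he.broadcastInput _ _) (by simp [networkRun])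
      (val (decide (p = a))) (by simp [networkRun, he.input, broadcastInputs]) p
      (by simp [networkRun])).1
    obtain ⟨r, hr⟩ := this
    refine ⟨r, ?_⟩
    -- Committing depends only on the start, input and receptions of `p`, and `p` is the copy
    -- `(true, p)` in both runs.
    simpa [Run.CommitsAt, Run.Active, Run.localHist, networkRun, hp] using hr
  have := hP.agreement Δ _ hΔ le_rfl
    (he.isExecution hΔ (H := {L}ᶜ) (c := fun _ => true) (by simpa using hf)
      (fun p _ q hq => if_neg (by simpa using hq)))
    (he.broadcastInput _ _) a (by simpa [networkRun] using ha) b (by simpa [networkRun] using hb)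
    _ _ (hgood a ha) (hgood b hb)
  simp [val, hab.symm] at this
  exact hxy this

/-- For `4 ≤ n < 4f` the parties other than `L` split into four groups `A`, `B`, `C`, `D` such that
each of `B`, `C`, `A ∪ {L}`, `D ∪ {L}` may be Byzantine. -/
theorem exists_four_groups (L : Fin n) (hn : 4 ≤ n) (hnf : n < 4 * f) :
    ∃ A B C D : Finset (Fin n), A.Nonempty ∧ B.Nonempty ∧ D.Nonempty ∧
      B.card ≤ f ∧ C.card ≤ f ∧ A.card + 1 ≤ f ∧ D.card + 1 ≤ f ∧
      L ∉ A ∧ L ∉ B ∧ L ∉ C ∧ L ∉ D ∧ Disjoint A B ∧ Disjoint A C ∧ Disjoint A D ∧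
      Disjoint B C ∧ Disjoint B D ∧ Disjoint C D ∧
      ∀ p, p ≠ L → p ∈ A ∨ p ∈ B ∨ p ∈ C ∨ p ∈ D := by
  classical
  have hS : ({L}ᶜ : Finset (Fin n)).card = n - 1 := by simp [Finset.card_compl]
  obtain ⟨S, hSL, hSc⟩ := Finset.exists_subset_card_eq
    -- `S` becomes `A ∪ B`, with capacity `(f - 1) + f`; the cap `n - 2` leaves a party for `D`. The
    -- four capacities add up to `4f - 2`, enough for the `n - 1` non-broadcasters. Only `C` may be
    -- empty.
    (s := ({L}ᶜ : Finset (Fin n))) (n := min (2 * f - 1) (n - 2)) (by omega)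
  obtain ⟨A, hAS, hAc⟩ := Finset.exists_subset_card_eq
    (s := S) (n := min (f - 1) (S.card - 1)) (by omega)
  have hS' : (({L}ᶜ : Finset (Fin n)) \ S).card = n - 1 - S.card := by
    rw [Finset.card_sdiff_of_subset hSL, hS]
  obtain ⟨D, hDS, hDc⟩ := Finset.exists_subset_card_eq
    (s := ({L}ᶜ : Finset (Fin n)) \ S) (n := min (f - 1) (n - 1 - S.card)) (by omega)
  have hB : (S \ A).card = S.card - A.card := Finset.card_sdiff_of_subset hAS
  have hC : ((({L}ᶜ : Finset (Fin n)) \ S) \ D).card = n - 1 - S.card - D.card := by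
    rw [Finset.card_sdiff_of_subset hDS, hS']
  have hL : L ∉ S := fun h => by simpa using hSL h
  refine ⟨A, S \ A, (({L}ᶜ : Finset (Fin n)) \ S) \ D, D, Finset.card_pos.1 (by omega),
    Finset.card_pos.1 (by omega), Finset.card_pos.1 (by omega), by omega, by omega, by omega,
    by omega, fun h => hL (hAS h), by simp [hL], by simp, fun h => by simpa using hDS h,
    ?_, ?_, ?_, ?_, ?_, ?_, ?_⟩
  · exact Finset.disjoint_sdiff
  · exact Finset.disjoint_left.2 fun p h h' => by
      simp only [Finset.mem_sdiff] at h'; exact h'.1.2 (hAS h)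
  · exact Finset.disjoint_left.2 fun p h h' => (Finset.mem_sdiff.1 (hDS h')).2 (hAS h)
  · exact Finset.disjoint_left.2 fun p h h' => by
      simp only [Finset.mem_sdiff] at h h'; exact h'.1.2 h.1
  · exact Finset.disjoint_left.2 fun p h h' =>
      (Finset.mem_sdiff.1 (hDS h')).2 (Finset.mem_sdiff.1 h).1
  · exact Finset.sdiff_disjoint
  · intro p hp
    simp only [Finset.mem_sdiff, Finset.mem_compl, Finset.mem_singleton]
    tauto

/-- In the world `none`, `a ∈ A` cannot rule out the good case for `x` before `3δ`, nor can `d ∈ D`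
rule out the one for `y`. A party `b ∈ B` is honest both when `D ∪ {L}` and when `A ∪ {L}` is
Byzantine, so it must agree with `a` and with `d`. -/
theorem three_mul_le_latency [Nontrivial V] (hn : 4 ≤ n) (hnf : n < 4 * f)
    (hP : SolvesBB P L f Δ) {T : ℝ → ℝ} (hT : GoodCaseLatency P L f Δ T) (hδ : 0 < δ)
    (hδΔ : δ ≤ Δ) : 3 * δ ≤ T δ := by
  classical
  by_contra! hlt
  obtain ⟨x, y, hxy⟩ := exists_pair_ne V
  obtain ⟨A, B, C, D, ⟨a, ha⟩, ⟨b, hb⟩, ⟨d, hd⟩, cB, cC, cA, cD, LA, LB, LC, LD,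
    AB, AC, AD, BC, BD, CD, hcov⟩ := exists_four_groups L hn hnf
  rw [Finset.disjoint_left] at AB AC AD BC BD CD
  -- `some true` and `some false` are good cases in which `C` and `B`, respectively, are Byzantine
  let src : Option Bool → Fin n → Fin n → Option Bool := fun i p q =>
    match i with
    | some true => if q ∈ C then none else some true
    | some false => if q ∈ B then none else some false
    -- The broadcaster shows `x` to `A ∪ B` and `y` to the others. Genuine messages from `D` would
    -- betray `y` to `A` by time `2δ`, so `A` hears `D` from the good case for `x`, and `D` hears
    -- `A` from the one for `y`. This is permitted because `A` and `D` are never honest together.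
    | none =>
      if q = L then (if p ∈ A ∨ p ∈ B then some true else some false)
      else if p ∈ A ∧ q ∈ D then some true
      else if p ∈ D ∧ q ∈ A then some false
      else none
  let val : Option Bool → V := fun i => if i = some true then x else y
  obtain ⟨e, he⟩ := exists_isNetwork P hδ src (broadcastInputs L val)
  have inp_eq : ∀ {i j : Option Bool} {p : Fin n}, (p = L → i = j) →
      broadcastInputs L val i p = broadcastInputs L val j p := by
    intro i j p h
    unfold broadcastInputs
    split_ifs with hp
    · rw [h hp]
    · rfl
  have ind_of_eq : ∀ {k : ℕ} {i j : Option Bool} {p : Fin n}, i = j →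
      Indistinguishable src (broadcastInputs L val) k i j p := by
    rintro k i _ p rfl
    exact .refl k i p
  have ind1 : Indistinguishable src (broadcastInputs L val) 2 (some true) none a := by
    refine ⟨inp_eq (by rintro rfl; exact absurd ha LA), fun q => ?_⟩
    by_cases hqL : q = L
    · exact ind_of_eq (by simp [src, hqL, LC, ha])
    rcases hcov q hqL with hq | hq | hq | hq
    -- The sender is a different copy in the two worlds, but both copies hear the same copy of the
    -- broadcaster, which is all that can matter one hop earlier.
    · have h1 : src (some true) a q = some true := by simp [src, AC hq]
      have h2 : src none a q = none := by simp [src, hqL, AD hq, AD ha]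
      rw [h1, h2]
      exact ⟨inp_eq fun h => absurd h hqL, fun q' => inp_eq (by
        rintro rfl; simp [src, LC, hq])⟩
    · have h1 : src (some true) a q = some true := by simp [src, BC hq]
      have h2 : src none a q = none := by simp [src, hqL, BD hq, AD ha]
      rw [h1, h2]
      exact ⟨inp_eq fun h => absurd h hqL, fun q' => inp_eq (by
        rintro rfl; simp [src, LC, hq])⟩
    · exact ind_of_eq (by simp [src, hqL, hq, CD hq, AD ha])
    · have h1 : q ∉ C := fun h => CD h hq
      exact ind_of_eq (by simp [src, hqL, hq, h1, ha])
  have ind2 : Indistinguishable src (broadcastInputs L val) 2 (some false) none d := by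
    have hdA : d ∉ A := fun h => AD h hd
    have hdB : d ∉ B := fun h => BD h hd
    refine ⟨inp_eq (by rintro rfl; exact absurd hd LD), fun q => ?_⟩
    by_cases hqL : q = L
    · exact ind_of_eq (by simp [src, hqL, LB, hdA, hdB])
    rcases hcov q hqL with hq | hq | hq | hq
    · exact ind_of_eq (by simp [src, hqL, hq, AB hq, hd, hdA])
    · have h1 : q ∉ A := fun h => AB h hq
      exact ind_of_eq (by simp [src, hqL, hq, hdA, h1])
    · have hqA : q ∉ A := fun h => AC h hq
      have hqB : q ∉ B := fun h => BC h hq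
      have h1 : src (some false) d q = some false := by simp [src, hqB]
      have h2 : src none d q = none := by simp [src, hqL, hdA, hqA]
      rw [h1, h2]
      exact ⟨inp_eq fun h => absurd h hqL, fun q' => inp_eq (by
        rintro rfl; simp [src, LB, hqA, hqB])⟩
    · have hqA : q ∉ A := fun h => AD h hq
      have hqB : q ∉ B := fun h => BD h hq
      have h1 : src (some false) d q = some false := by simp [src, hqB]
      have h2 : src none d q = none := by simp [src, hqL, hdA, hqA]
      rw [h1, h2]
      exact ⟨inp_eq fun h => absurd h hqL, fun q' => inp_eq (by
        rintro rfl; simp [src, LB, hqA, hqB])⟩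
  have com1 : (e none).Commits P a (some x) := by
    obtain ⟨r, hr, hc⟩ := he.commitsAt_of_latency hP hT hδ hδΔ (H := Cᶜ) (i := some true)
      (by simpa using cC) (fun p _ q hq => if_neg (by simpa using hq)) (by simpa using LC)
      (p := a) (by simpa using AC ha)
    exact ⟨r, (ind1.sameUntil he (by push_cast; linarith)).commitsAt hc⟩
  have com2 : (e none).Commits P d (some y) := by
    obtain ⟨r, hr, hc⟩ := he.commitsAt_of_latency hP hT hδ hδΔ (H := Bᶜ) (i := some false)
      (by simpa using cB) (fun p _ q hq => if_neg (by simpa using hq)) (by simpa using LB)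
      (p := d) (by simpa using fun h => BD h hd)
    exact ⟨r, (ind2.sameUntil he (by push_cast; linarith)).commitsAt hc⟩
  have hbL : b ≠ L := by rintro rfl; exact LB hb
  have haL : a ≠ L := by rintro rfl; exact LA ha
  have hdL : d ≠ L := by rintro rfl; exact LD hd
  have exec : ∀ E : Finset (Fin n), E = A ∨ E = D →
      IsExecution P f δ (networkRun e (insert L E)ᶜ (fun _ => none)) := by
    intro E hE
    refine he.isExecution hδ ?_ ?_
    · rw [compl_compl]
      refine (Finset.card_insert_le _ _).trans ?_
      rcases hE with rfl | rfl <;> assumption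
    · intro p hp q hq
      simp only [Finset.mem_compl, Finset.mem_insert, not_or] at hp hq
      rcases hE with rfl | rfl <;> simp [src, hp, hq]
  have mem : ∀ {E : Finset (Fin n)} {p : Fin n}, p ≠ L → p ∉ E →
      p ∈ (networkRun e (insert L E)ᶜ (fun _ => none)).honest := by
    intro E p h1 h2
    simp [networkRun, h1, h2]
  have bA := mem (E := A) hbL fun h => AB h hb
  have bD := mem (E := D) hbL (BD hb)
  -- The commit of `b` obtained in one execution serves in both, since `b` is the same copy with the
  -- same history.
  obtain ⟨-, -, -, r, -, o, ho⟩ := hP.termination δ _ hδ hδΔ (exec A (.inl rfl))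
    (he.broadcastInput _ _) b bA
  have e1 := hP.agreement δ _ hδ hδΔ (exec D (.inr rfl)) (he.broadcastInput _ _)
    a (mem haL (AD ha)) b bD _ o com1 ⟨r, ho⟩
  have e2 := hP.agreement δ _ hδ hδΔ (exec A (.inl rfl)) (he.broadcastInput _ _)
    d (mem hdL fun h => AD h hd) b bA _ o com2 ⟨r, ho⟩
  exact hxy (Option.some.inj (e1.trans e2.symm))

end LowerBounds

/-! ### Quorums, acks, votes and locks in a history -/

section Histories

variable {n : ℕ} {V : Type u} {M : Type w} {L : Fin n} {h : History n (Msg V M)}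

theorem Quorum.mono {k : ℕ} {m : Msg V M} {s t : ℝ} (hq : Quorum L k h m s) (hst : s ≤ t) :
    Quorum L k h m t :=
  le_trans hq (Set.ncard_le_ncard
    (fun _ ⟨h1, s', h2, h3⟩ => ⟨h1, s', h2.trans hst, h3⟩) (Set.toFinite _))

theorem exists_firstTime {Q : ℝ → Prop} {F : Set ℝ} (hF : F.Finite) {t : ℝ}
    (hQ : ∀ s ≤ t, Q s → ∃ s' ∈ F, s' ≤ s ∧ Q s') (ht : Q t) : ∃ s ≤ t, FirstTime Q s := by
  obtain ⟨t', ht'F, ht't, ht'⟩ := hQ t le_rfl ht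
  obtain ⟨s, ⟨hsF, hs⟩, hmin⟩ := Set.exists_min_image {s ∈ F | Q s} id
    (hF.subset (Set.sep_subset _ _)) ⟨t', ht'F, ht'⟩
  have hst : s ≤ t := (hmin t' ⟨ht'F, ht'⟩).trans ht't
  refine ⟨s, hst, hs, fun r hr hQr => ?_⟩
  obtain ⟨r', hr'F, hr'r, hr'⟩ := hQ r (hr.le.trans hst) hQr
  exact absurd (hmin r' ⟨hr'F, hr'⟩) (not_le.2 (hr'r.trans_lt hr))

/-- A quorum can only arise at a reception time, and there are finitely many of these up to `t`. An
empty quorum (`k = 0`) would hold at all times and have no first one. -/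
theorem Quorum.exists_firstTime (hh : LocallyFinite h) {k : ℕ} (hk : 1 ≤ k) {m : Msg V M} {t : ℝ}
    (hq : Quorum L k h m t) : ∃ s ≤ t, FirstTime (Quorum L k h m) s := by
  refine SyncBB.exists_firstTime ((hh t).image Prod.fst) (fun s hst hs => ?_) hq
  have hne : {q : Fin n | q ≠ L ∧ ∃ s' : ℝ, s' ≤ s ∧ (s', q, m) ∈ h}.Nonempty :=
    (Set.ncard_pos (Set.toFinite _)).1 (lt_of_lt_of_le hk hs)
  choose! τ hτ using fun (q : Fin n)
    (hq : q ∈ {q : Fin n | q ≠ L ∧ ∃ s' : ℝ, s' ≤ s ∧ (s', q, m) ∈ h}) => hq.2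
  obtain ⟨q, hq, hmax⟩ := Set.exists_max_image _ τ (Set.toFinite _) hne
  refine ⟨τ q, ⟨(τ q, q, m), ⟨(hτ q hq).2, (hτ q hq).1.trans hst⟩, rfl⟩, (hτ q hq).1, ?_⟩
  exact le_trans hs (Set.ncard_le_ncard
    (fun q' hq' => ⟨hq'.1, τ q', hmax q' hq', (hτ q' hq').2⟩) (Set.toFinite _))

theorem acksAt_upTo {pick : Set V → V} {t : ℝ} {x : V} :
    AcksAt L pick (upTo h t) t x ↔ AcksAt L pick h t x := by
  have h1 := firstTime_upTo (h := h) (t := t) (Q := fun (h : History n (Msg V M)) s =>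
    ∃ y : V, ∃ s' : ℝ, s' ≤ s ∧ (s', L, Msg.propose y) ∈ h) (fun s t hst =>
      exists_congr fun y => exists_congr fun s' => and_congr_right fun hs' =>
        ⟨fun H => H.1, fun H => ⟨H, hs'.trans hst⟩⟩)
  have h2 : {y : V | (t, L, Msg.propose y) ∈ upTo h t} = {y : V | (t, L, Msg.propose y) ∈ h} := by
    ext y
    exact ⟨fun H => H.1, fun H => ⟨H, le_rfl⟩⟩
  unfold AcksAt
  rw [h2]
  exact and_congr_left fun _ => h1

theorem AcksAt.unique {pick : Set V → V} {s t : ℝ} {x y : V} (hx : AcksAt L pick h s x)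
    (hy : AcksAt L pick h t y) : x = y := by
  obtain rfl := hx.1.unique hy.1
  exact hx.2.trans hy.2.symm

theorem AcksAt.mem_propose {pick : Set V → V} (hpick : ∀ S : Set V, S.Nonempty → pick S ∈ S)
    {t : ℝ} {x : V} (hx : AcksAt L pick h t x) : (t, L, Msg.propose x) ∈ h := by
  obtain ⟨⟨⟨y, s, hst, hy⟩, hfirst⟩, rfl⟩ := hx
  obtain rfl : s = t := hst.antisymm (not_lt.1 fun hlt => hfirst s hlt ⟨y, s, le_rfl, hy⟩)
  exact hpick {y : V | (s, L, Msg.propose y) ∈ h} ⟨y, hy⟩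

theorem VotesAt.quorum {f : ℕ} {pick : Set V → V}
    (hpick : ∀ S : Set V, S.Nonempty → pick S ∈ S) {t : ℝ} {x : V}
    (hx : VotesAt L f pick (upTo h t) t x) : Quorum L (n - 2 * f) h (.ack x) t := by
  obtain ⟨⟨hne, -⟩, rfl⟩ := hx
  exact (quorum_upTo L _ h _ le_rfl).1
    (hpick {y : V | Quorum L (n - 2 * f) (upTo h t) (.ack y) t} hne)

/-- If no other value than `x` is ever assigned to the lock, and `x` is assigned by time `T`,
then `x` is the lock at time `T`. -/
theorem lock_eq_some {f : ℕ} {pick : Set V → V} (hpick : ∀ S : Set V, S.Nonempty → pick S ∈ S)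
    {t T : ℝ} {x : V} (htT : t ≤ T) (ht : SetsLockAt L f h t x)
    (huniq : ∀ s y, SetsLockAt L f h s y → y = x) : lock L f pick h T = some x := by
  have hfin : {s : ℝ | SetsLockAt L f h s x}.Finite := by
    have hsub : ∀ Q : ℝ → Prop, {s | FirstTime Q s}.Finite := fun Q =>
      Set.Subsingleton.finite fun _ hs _ ht => FirstTime.unique hs ht
    exact (((hsub _).union ((hsub _).union (hsub _))))
  obtain ⟨s, ⟨hs, hsT⟩, hmax⟩ := Set.exists_max_image
    {s : ℝ | SetsLockAt L f h s x ∧ s ≤ T} id (hfin.subset (Set.sep_subset _ _)) ⟨t, ht, htT⟩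
  unfold lock
  rw [if_pos ⟨x, t, htT, ht⟩]
  obtain ⟨s', -, hs', -⟩ := hpick {x : V | ∃ t : ℝ, t ≤ T ∧ SetsLockAt L f h t x ∧
      ∀ (y : V) (s : ℝ), s ≤ T → SetsLockAt L f h s y → s ≤ t}
    ⟨x, s, hsT, hs, fun y r hr hry => hmax r ⟨huniq r y hry ▸ hry, hr⟩⟩
  rw [huniq s' _ hs']

end Histories

/-! ### Transmission between honest parties in local time -/

section Executions

variable {n : ℕ} {I : Type u} {O : Type v} {M : Type w} {P : Protocol n I O M} {f : ℕ} {δ : ℝ}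
  {e : Run n I M} {p q : Fin n} {m : M}

theorem Run.nonneg_of_mem_localHist {s : ℝ} (hs : (s, q, m) ∈ e.localHist p) : 0 ≤ s := by
  obtain ⟨r, -, hr⟩ := hs
  simp only at hr
  rw [hr]
  exact le_max_left _ _

theorem IsExecution.locallyFinite (he : IsExecution P f δ e) (hp : p ∈ e.honest) :
    LocallyFinite (e.localHist p) := by
  intro T
  refine ((he.finite_recv p hp (e.start p + T)).image
    (fun a : ℝ × Fin n × M => ((max 0 (a.1 - e.start p), a.2) : ℝ × Fin n × M))).subset ?_
  rintro ⟨s, q, m⟩ ⟨⟨r, hr, hs⟩, hst⟩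
  simp only at hr hs hst
  have := le_max_right 0 (r - e.start p)
  exact ⟨(r, q, m), ⟨hr, by simp only; linarith⟩, by rw [hs]⟩

theorem IsExecution.exists_mem_localHist (he : IsExecution P f δ e) (hq : q ∈ e.honest)
    (hp : p ∈ e.honest) {r : ℝ} (hm : e.Sends P q r p m) :
    ∃ s ≤ max 0 (r + δ - e.start p), (s, q, m) ∈ e.localHist p := by
  obtain ⟨delay, hdelay, hrecv⟩ := he.delivery
  refine ⟨_, ?_, _, (hrecv q hq p hp _ m).2 ⟨r, hm, rfl⟩, rfl⟩
  have := (hdelay q p r m).2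
  exact max_le_max le_rfl (by linarith)

theorem IsExecution.exists_sends (he : IsExecution P f δ e) (hq : q ∈ e.honest)
    (hp : p ∈ e.honest) {s : ℝ} (hs : (s, q, m) ∈ e.localHist p) :
    ∃ r < e.start p + s, e.Sends P q r p m := by
  obtain ⟨delay, hdelay, hrecv⟩ := he.delivery
  obtain ⟨r', hr', hs⟩ := hs
  obtain ⟨r, hr, rfl⟩ := (hrecv q hq p hp _ m).1 hr'
  refine ⟨r, ?_, hr⟩
  simp only at hs
  have h1 := (hdelay q p r m).1
  have h2 := le_max_right 0 (r + delay q p r m - e.start p)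
  linarith

end Executions

/-! ### Acks and locks in executions of the broadcast -/

section Broadcast

variable {n : ℕ} {V : Type u} {M : Type w} {L : Fin n} {f : ℕ} {Δ σ δ : ℝ}
  {pick : Fin n → Set V → V} {B : Protocol n (Option V) (Option V) M}
  {e : Run n (Option V) (Msg V M)} {p q : Fin n} {x y : V} {s t : ℝ}

theorem active_broadcast (h0 : 0 ≤ t) (ht : t ≤ 3 * Δ + 2 * σ) :
    e.Active (broadcast L f Δ σ pick B) p t :=
  ⟨h0, fun _ _ hs hh => absurd hh.1 (not_le.2 (hs.trans_le ht))⟩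

theorem IsExecution.acksAt_of_mem (he : IsExecution (broadcast L f Δ σ pick B) f δ e)
    (hq : q ∈ e.honest) (hp : p ∈ e.honest) (hs : (s, q, Msg.ack x) ∈ e.localHist p) :
    ∃ t, e.start q + t < e.start p + s ∧ AcksAt L (pick q) (e.localHist q) t x := by
  obtain ⟨r, hr, -, hm⟩ := he.exists_sends hq hp hs
  exact ⟨r - e.start q, by linarith, acksAt_upTo.1 hm⟩

theorem IsExecution.quorum_of_vote_mem (he : IsExecution (broadcast L f Δ σ pick B) f δ e)
    (hpick : ∀ p S, S.Nonempty → pick p S ∈ S) (hq : q ∈ e.honest) (hp : p ∈ e.honest)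
    (hs : (s, q, Msg.vote x) ∈ e.localHist p) :
    ∃ t, Quorum L (n - 2 * f) (e.localHist q) (.ack x) t := by
  obtain ⟨r, hr, -, hm⟩ := he.exists_sends hq hp hs
  exact ⟨r - e.start q, VotesAt.quorum (hpick q) hm⟩

/-- The bound on `t` ensures that the sender has not terminated: nobody does before the agreement is
invoked. -/
theorem IsExecution.ack_mem (he : IsExecution (broadcast L f Δ σ pick B) f δ e)
    (hq : q ∈ e.honest) (hp : p ∈ e.honest) (hpick : ∀ p S, S.Nonempty → pick p S ∈ S)
    (hack : AcksAt L (pick q) (e.localHist q) t x) (ht : t ≤ 3 * Δ + 2 * σ) :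
    ∃ s ≤ max 0 (e.start q + t + δ - e.start p), (s, q, Msg.ack x) ∈ e.localHist p := by
  refine he.exists_mem_localHist hq hp ⟨?_, ?_⟩
  · rw [add_sub_cancel_left]
    exact active_broadcast (Run.nonneg_of_mem_localHist (hack.mem_propose (hpick q))) ht
  · rw [add_sub_cancel_left]
    exact acksAt_upTo.2 hack

theorem IsExecution.acksAt_eq_input (he : IsExecution (broadcast L f Δ σ pick B) f δ e)
    (hpick : ∀ p S, S.Nonempty → pick p S ∈ S) (hL : L ∈ e.honest) (hx : e.input L = some x)
    (hq : q ∈ e.honest) (hack : AcksAt L (pick q) (e.localHist q) t y) : y = x := by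
  obtain ⟨r, -, -, hm⟩ := he.exists_sends hL hq (hack.mem_propose (hpick q))
  have := hm.2.2
  rw [hx] at this
  exact (Option.some.inj this).symm

theorem IsExecution.exists_acksAt (he : IsExecution (broadcast L f Δ σ pick B) f δ e)
    (hpick : ∀ p S, S.Nonempty → pick p S ∈ S) (hΔ : 0 ≤ Δ) (hσ : 0 ≤ σ) (hL : L ∈ e.honest)
    (hx : e.input L = some x) (hq : q ∈ e.honest) :
    ∃ t ≤ max 0 (e.start L + δ - e.start q), AcksAt L (pick q) (e.localHist q) t x := by
  obtain ⟨s, hs, hm⟩ := he.exists_mem_localHist hL hq (r := e.start L) (m := Msg.propose x)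
    ⟨by rw [sub_self]; exact active_broadcast le_rfl (by linarith), rfl, sub_self _, hx⟩
  obtain ⟨t, hts, ht⟩ := exists_firstTime
    (Q := fun s => ∃ y : V, ∃ s' : ℝ, s' ≤ s ∧ (s', L, Msg.propose y) ∈ e.localHist q)
    ((he.locallyFinite hq s).image Prod.fst)
    (fun r hr ⟨y, s', hs', hy⟩ => ⟨s', ⟨_, ⟨hy, hs'.trans hr⟩, rfl⟩, hs', y, s', le_rfl, hy⟩)
    ⟨x, s, le_rfl, hm⟩
  have hack : AcksAt L (pick q) (e.localHist q) t
    (pick q {y : V | (t, L, Msg.propose y) ∈ e.localHist q}) := ⟨ht, rfl⟩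
  rw [he.acksAt_eq_input hpick hL hx hq hack] at hack
  exact ⟨t, hts.trans hs, hack⟩

theorem card_honest_erase (he : e.honestᶜ.card ≤ f) : n - f - 1 ≤ (e.honest.erase L).card := by
  rw [Finset.card_compl, Fintype.card_fin] at he
  have := Finset.pred_card_le_card_erase (s := e.honest) (a := L)
  omega

/-- If the broadcaster is honest, then every honest party gets enough acks for its input within
time `2δ` since the broadcaster starts. -/
theorem IsExecution.quorum_of_honest (he : IsExecution (broadcast L f Δ σ pick B) f δ e)
    (hpick : ∀ p S, S.Nonempty → pick p S ∈ S) (hδ : 0 < δ) (hδΔ : δ ≤ Δ) (hδσ : δ ≤ σ)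
    (hL : L ∈ e.honest) (hx : e.input L = some x) (hp : p ∈ e.honest) :
    Quorum L (n - f - 1) (e.localHist p) (.ack x) (e.start L + 2 * δ - e.start p) := by
  refine le_trans (card_honest_erase (L := L) he.byzantine) ?_
  rw [← Set.ncard_coe_finset]
  refine Set.ncard_le_ncard ?_ (Set.toFinite _)
  intro q hq
  simp only [Finset.coe_erase, Set.mem_sdiff, Finset.mem_coe, Set.mem_singleton_iff] at hq
  obtain ⟨t, ht, hack⟩ :=
    he.exists_acksAt hpick (hδ.le.trans hδΔ) (hδ.le.trans hδσ) hL hx hq.1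
  have h1 := abs_le.1 (he.skew L hL q hq.1)
  have h2 := abs_le.1 (he.skew L hL p hp)
  have ht' : t ≤ e.start L + δ - e.start q := ht.trans (max_le (by linarith) le_rfl)
  obtain ⟨s, hs, hm⟩ := he.ack_mem hq.1 hp hpick hack (by linarith)
  exact ⟨hq.2, s, hs.trans (max_le (by linarith) (by linarith)), hm⟩

/-- If the honest parties in `W` can only ack `x`, and `W` is so large that the other parties
cannot form a quorum, then no other value is ever assigned to a lock. -/
theorem IsExecution.eq_of_setsLockAt (he : IsExecution (broadcast L f Δ σ pick B) f δ e)
    (hpick : ∀ p S, S.Nonempty → pick p S ∈ S) {W : Finset (Fin n)} (hW : W ⊆ e.honest.erase L)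
    (hack : ∀ q ∈ W, ∀ t y, AcksAt L (pick q) (e.localHist q) t y → y = x)
    (h1 : n - 1 - W.card < n - 2 * f) (h2 : n - 1 - W.card < n - f - 1) (h3 : f < n - f - 1)
    (hp : p ∈ e.honest) (hy : SetsLockAt L f (e.localHist p) t y) : y = x := by
  have quorum_ack : ∀ {k : ℕ} {p : Fin n} {t : ℝ} {y : V}, n - 1 - W.card < k → p ∈ e.honest →
      Quorum L k (e.localHist p) (.ack y) t → y = x := by
    intro k p t y hk hp hq
    by_contra hyx
    have hsub : {q : Fin n | q ≠ L ∧ ∃ s : ℝ, s ≤ t ∧ (s, q, Msg.ack y) ∈ e.localHist p} ⊆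
        (({L}ᶜ \ W : Finset (Fin n)) : Set (Fin n)) := by
      rintro q ⟨hqL, s, -, hs⟩
      simp only [Finset.coe_sdiff, Finset.coe_compl, Finset.coe_singleton, Set.mem_sdiff,
        Set.mem_compl_iff, Set.mem_singleton_iff, Finset.mem_coe]
      refine ⟨hqL, fun hqW => hyx ?_⟩
      obtain ⟨t, -, ht⟩ := he.acksAt_of_mem (Finset.mem_of_mem_erase (hW hqW)) hp hs
      exact hack q hqW t y ht
    have hle := Set.ncard_le_ncard hsub (Set.toFinite _)
    rw [Set.ncard_coe_finset, Finset.card_sdiff_of_subset (fun q hq => by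
      simpa using Finset.ne_of_mem_erase (hW hq)), Finset.card_compl, Fintype.card_fin,
      Finset.card_singleton] at hle
    have : k ≤ _ := hq
    omega
  rcases hy with hy | hy | hy
  · exact quorum_ack h2 hp hy.1
  · exact quorum_ack h1 hp hy.1
  · by_contra hyx
    have hsub : {q : Fin n | q ≠ L ∧ ∃ s : ℝ, s ≤ t ∧ (s, q, Msg.vote y) ∈ e.localHist p} ⊆
        ((e.honestᶜ : Finset (Fin n)) : Set (Fin n)) := by
      rintro q ⟨hqL, s, -, hs⟩
      rw [Finset.mem_coe, Finset.mem_compl]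
      intro hq
      -- An honest vote for `y` needs `n - 2f` acks for `y`, already excluded; so all these votes
      -- are Byzantine, at most `f < n - f - 1` of them.
      obtain ⟨t, ht⟩ := he.quorum_of_vote_mem hpick hq hp hs
      exact hyx (quorum_ack h1 hq ht)
    have hle := Set.ncard_le_ncard hsub (Set.toFinite _)
    rw [Set.ncard_coe_finset] at hle
    have hb := he.byzantine
    have : n - f - 1 ≤ _ := hy.1
    omega

theorem IsExecution.lock_eq_input (he : IsExecution (broadcast L f Δ σ pick B) f δ e)
    (hpick : ∀ p S, S.Nonempty → pick p S ∈ S) (hn : 2 ≤ n) (hnf : 4 * f ≤ n) (hδ : 0 < δ)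
    (hδΔ : δ ≤ Δ) (hδσ : δ ≤ σ) (hL : L ∈ e.honest) (hx : e.input L = some x)
    (hp : p ∈ e.honest) : lock L f (pick p) (e.localHist p) (3 * Δ + 2 * σ) = some x := by
  have hW := card_honest_erase (L := L) he.byzantine
  obtain ⟨t, ht, hfirst⟩ := (he.quorum_of_honest hpick hδ hδΔ hδσ hL hx hp).exists_firstTime
    (he.locallyFinite hp) (by omega)
  have h2 := abs_le.1 (he.skew L hL p hp)
  refine lock_eq_some (hpick p) (by linarith) (.inl hfirst) fun s y hy => ?_
  exact he.eq_of_setsLockAt hpick (W := e.honest.erase L) subset_rfl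
    (fun q hq t y => he.acksAt_eq_input hpick hL hx (Finset.mem_of_mem_erase hq))
    (by omega) (by omega) (by omega) hp hy

/-- If an honest party gets enough acks for `x` in time, then all honest parties lock `x`. -/
theorem IsExecution.lock_eq_of_quorum (he : IsExecution (broadcast L f Δ σ pick B) f δ e)
    (hpick : ∀ p S, S.Nonempty → pick p S ∈ S) (hn : 2 ≤ n) (hnf : 4 * f ≤ n) (hδ : 0 < δ)
    (hδΔ : δ ≤ Δ) (hδσ : δ ≤ σ) (hb : BroadcastInput L e) (hp : p ∈ e.honest)
    (hx : Quorum L (n - f - 1) (e.localHist p) (.ack x) (2 * Δ + σ)) (hq : q ∈ e.honest) :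
    lock L f (pick q) (e.localHist q) (3 * Δ + 2 * σ) = some x := by
  classical
  -- If `L` is honest, `f` of the acks may be Byzantine and the count below would fall one short of
  -- `n - 2f`; but then honest parties ack only the input of `L`.
  by_cases hL : L ∈ e.honest
  · obtain ⟨z, hz⟩ := Option.isSome_iff_exists.1 ((hb L hL).2 rfl)
    have hW := card_honest_erase (L := L) he.byzantine
    obtain ⟨t, -, ht⟩ := hx.exists_firstTime (he.locallyFinite hp) (by omega)
    obtain rfl : x = z := he.eq_of_setsLockAt hpick (W := e.honest.erase L) subset_rfl
      (fun q hq t y => he.acksAt_eq_input hpick hL hz (Finset.mem_of_mem_erase hq))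
      (by omega) (by omega) (by omega) hp (.inl ht)
    exact he.lock_eq_input hpick hn hnf hδ hδΔ hδσ hL hz hq
  · let W := e.honest.filter fun q =>
      q ≠ L ∧ ∃ s : ℝ, s ≤ 2 * Δ + σ ∧ (s, q, Msg.ack x) ∈ e.localHist p
    have hWack : ∀ q ∈ W, ∃ t, e.start q + t < e.start p + (2 * Δ + σ) ∧
        AcksAt L (pick q) (e.localHist q) t x := by
      intro q hq
      obtain ⟨hq, hqL, s, hs, hm⟩ := Finset.mem_filter.1 hq
      obtain ⟨t, ht, hack⟩ := he.acksAt_of_mem hq hp hm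
      exact ⟨t, by linarith, hack⟩
    have hsub : {q : Fin n | q ≠ L ∧ ∃ s : ℝ, s ≤ 2 * Δ + σ ∧
        (s, q, Msg.ack x) ∈ e.localHist p} ⊆ ((W ∪ e.honestᶜ.erase L : Finset (Fin n)) :
          Set (Fin n)) := by
      intro q hq
      rw [Finset.mem_coe, Finset.mem_union]
      by_cases hqh : q ∈ e.honest
      · exact .inl (Finset.mem_filter.2 ⟨hqh, hq⟩)
      · exact .inr (Finset.mem_erase.2 ⟨hq.1, Finset.mem_compl.2 hqh⟩)
    have hcard := Set.ncard_le_ncard hsub (Set.toFinite _)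
    rw [Set.ncard_coe_finset] at hcard
    have hunion := Finset.card_union_le W (e.honestᶜ.erase L)
    have hLb : L ∈ e.honestᶜ := Finset.mem_compl.2 hL
    rw [Finset.card_erase_of_mem hLb] at hunion
    have hpos := Finset.card_pos.2 ⟨L, hLb⟩
    have hbyz := he.byzantine
    have hx' : n - f - 1 ≤ _ := hx
    have hWq : Quorum L (n - 2 * f) (e.localHist q) (.ack x) (3 * Δ + 2 * σ) := by
      have hle : n - 2 * f ≤ W.card := by omega
      -- An ack counted by `p` was sent before its local time `2Δ + σ`; one delay and the skew
      -- between `p` and `q` add at most `2δ ≤ Δ + σ`.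
      refine hle.trans ?_
      rw [← Set.ncard_coe_finset]
      refine Set.ncard_le_ncard (fun r hr => ?_) (Set.toFinite _)
      obtain ⟨t, ht, hack⟩ := hWack r hr
      obtain ⟨hr, hrL, -⟩ := Finset.mem_filter.1 hr
      have h1 := abs_le.1 (he.skew p hp r hr)
      have h2 := abs_le.1 (he.skew p hp q hq)
      obtain ⟨s, hs, hm⟩ := he.ack_mem hr hq hpick hack (by linarith)
      exact ⟨hrL, s, hs.trans (max_le (by linarith) (by linarith)), hm⟩
    obtain ⟨t, ht, hfirst⟩ := hWq.exists_firstTime (he.locallyFinite hq) (by omega)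
    refine lock_eq_some (hpick q) ht (.inr (.inl hfirst)) fun s y hy => ?_
    refine he.eq_of_setsLockAt hpick (W := W) ?_ ?_ (by omega) (by omega) (by omega) hq hy
    · intro r hr
      obtain ⟨hr, hrL, -⟩ := Finset.mem_filter.1 hr
      exact Finset.mem_erase.2 ⟨hrL, hr⟩
    · intro r hr t y hy
      obtain ⟨t', -, hack⟩ := hWack r hr
      exact hy.unique hack

end Broadcast

/-! ### The inner Byzantine agreement and the correctness of the broadcast -/

section Agreement

variable {n : ℕ} {V : Type u} {M : Type w}

/-- The run of the Byzantine agreement that is invoked at local time `T` in a run of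
the broadcast. -/
noncomputable def agreementRun (L : Fin n) (f : ℕ) (T : ℝ) (pick : Fin n → Set V → V)
    (e : Run n (Option V) (Msg V M)) : Run n (Option V) M :=
  ⟨e.honest, fun p => e.start p + T, fun p => lock L f (pick p) (e.localHist p) T,
    fun p => {a | (a.1, a.2.1, Msg.ba a.2.2) ∈ e.recv p}⟩

variable {L : Fin n} {f : ℕ} {Δ σ δ T : ℝ}
  {pick : Fin n → Set V → V} {B : Protocol n (Option V) (Option V) M}
  {e : Run n (Option V) (Msg V M)} {p q : Fin n} {x : V} {o : Option V} {r t : ℝ}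

/-- Truncating at the start of the broadcast and then at the later start of the agreement is the
same as truncating once at the latter, as `T ≥ 0`. -/
theorem agreementRun_localHist (hT : 0 ≤ T) (p : Fin n) :
    (agreementRun L f T pick e).localHist p = baHist (e.localHist p) T := by
  have key : ∀ r, max 0 (max 0 (r - e.start p) - T) = max 0 (r - (e.start p + T)) := by
    intro r
    rcases le_total 0 (r - e.start p) with h | h
    · rw [max_eq_right h, sub_sub]
    · rw [max_eq_left h, max_eq_left (by linarith), max_eq_left (by linarith)]
  ext ⟨s, q, m⟩
  constructor
  · rintro ⟨r, hr, hs⟩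
    exact ⟨_, ⟨r, hr, rfl⟩, hs.trans (key r).symm⟩
  · rintro ⟨s', ⟨r, hr, hs'⟩, hs⟩
    simp only at hs' hs hr
    exact ⟨r, hr, by simp only [hs, hs', key]; rfl⟩

theorem halt_broadcast (hT : 0 ≤ 3 * Δ + 2 * σ) :
    (broadcast L f Δ σ pick B).halt p (e.input p) (upTo (e.localHist p) t) t ↔
      3 * Δ + 2 * σ ≤ t ∧ B.halt p ((agreementRun L f (3 * Δ + 2 * σ) pick e).input p)
        (upTo ((agreementRun L f (3 * Δ + 2 * σ) pick e).localHist p) (t - (3 * Δ + 2 * σ)))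
        (t - (3 * Δ + 2 * σ)) := by
  refine and_congr_right fun ht => ?_
  rw [lock_upTo L f (pick p) _ ht, baHist_upTo _ ht, agreementRun_localHist hT]
  rfl

theorem active_agreementRun (hT : 0 ≤ 3 * Δ + 2 * σ) :
    (agreementRun L f (3 * Δ + 2 * σ) pick e).Active B p (t - (3 * Δ + 2 * σ)) ↔
      3 * Δ + 2 * σ ≤ t ∧ e.Active (broadcast L f Δ σ pick B) p t := by
  constructor
  · rintro ⟨h0, h⟩
    refine ⟨by linarith, by linarith, fun s _ hst hs => ?_⟩
    obtain ⟨hTs, hs⟩ := (halt_broadcast hT).1 hs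
    exact h _ (by linarith) (by linarith) hs
  · rintro ⟨hTt, h0, h⟩
    refine ⟨by linarith, fun s hs0 hst hs => ?_⟩
    refine h (s + (3 * Δ + 2 * σ)) (by linarith) (by linarith) ((halt_broadcast hT).2 ⟨?_, ?_⟩)
    · linarith
    · rw [add_sub_cancel_right]
      exact hs

theorem sends_agreementRun (hT : 0 ≤ 3 * Δ + 2 * σ) {m : M} :
    (agreementRun L f (3 * Δ + 2 * σ) pick e).Sends B p r q m ↔
      e.Sends (broadcast L f Δ σ pick B) p r q (.ba m) := by
  have hsub : r - (agreementRun L f (3 * Δ + 2 * σ) pick e).start p =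
    r - e.start p - (3 * Δ + 2 * σ) := (sub_sub _ _ _).symm
  unfold Run.Sends
  rw [hsub, active_agreementRun hT, agreementRun_localHist hT, and_comm (a := _ ≤ _), and_assoc]
  refine and_congr_right fun _ => and_congr_right fun hr => ?_
  rw [← baHist_upTo _ hr]
  change _ ∈ B.send p (lock L f (pick p) (e.localHist p) _) _ _ q ↔ _
  rw [← lock_upTo L f (pick p) _ hr]

theorem commitsAt_broadcast (hΔ : 0 ≤ Δ) (hσ : 0 ≤ σ) :
    e.CommitsAt (broadcast L f Δ σ pick B) p r o ↔
      (e.Active (broadcast L f Δ σ pick B) p (r - e.start p) ∧ r - e.start p ≤ 2 * Δ + σ ∧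
        ∃ y : V, o = some y ∧ Quorum L (n - f - 1) (e.localHist p) (.ack y) (r - e.start p)) ∨
      ((¬ ∃ y : V, Quorum L (n - f - 1) (e.localHist p) (.ack y) (2 * Δ + σ)) ∧
        (agreementRun L f (3 * Δ + 2 * σ) pick e).CommitsAt B p r o) := by
  have hT : 0 ≤ 3 * Δ + 2 * σ := by linarith
  have hsub : r - (agreementRun L f (3 * Δ + 2 * σ) pick e).start p =
    r - e.start p - (3 * Δ + 2 * σ) := (sub_sub _ _ _).symm
  have early : (∃ y : V, o = some y ∧ Quorum L (n - f - 1)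
      (upTo (e.localHist p) (r - e.start p)) (.ack y) (r - e.start p)) ↔
      ∃ y : V, o = some y ∧ Quorum L (n - f - 1) (e.localHist p) (.ack y) (r - e.start p) :=
    exists_congr fun y => and_congr_right fun _ => quorum_upTo L _ _ _ le_rfl
  have late (hr : 3 * Δ + 2 * σ ≤ r - e.start p) : (∃ y : V, Quorum L (n - f - 1)
      (upTo (e.localHist p) (r - e.start p)) (.ack y) (2 * Δ + σ)) ↔
      ∃ y : V, Quorum L (n - f - 1) (e.localHist p) (.ack y) (2 * Δ + σ) :=
    exists_congr fun y => quorum_upTo L _ _ _ (by linarith)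
  have commit (hr : 3 * Δ + 2 * σ ≤ r - e.start p) :
      o ∈ B.commit p (lock L f (pick p) (upTo (e.localHist p) (r - e.start p)) (3 * Δ + 2 * σ))
        (baHist (upTo (e.localHist p) (r - e.start p)) (3 * Δ + 2 * σ))
        (r - e.start p - (3 * Δ + 2 * σ)) ↔
      o ∈ B.commit p ((agreementRun L f (3 * Δ + 2 * σ) pick e).input p)
        (upTo (baHist (e.localHist p) (3 * Δ + 2 * σ)) (r - e.start p - (3 * Δ + 2 * σ)))
        (r - e.start p - (3 * Δ + 2 * σ)) := by
    rw [lock_upTo L f (pick p) _ hr, baHist_upTo _ hr]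
    rfl
  unfold Run.CommitsAt
  rw [hsub, active_agreementRun hT, agreementRun_localHist hT]
  constructor
  · rintro ⟨hact, ⟨hr, h⟩ | ⟨hr, hno, h⟩⟩
    · exact .inl ⟨hact, hr, early.1 h⟩
    · exact .inr ⟨fun H => hno ((late hr).2 H), ⟨hr, hact⟩, (commit hr).1 h⟩
  · rintro (⟨hact, hr, h⟩ | ⟨hno, ⟨hr, hact⟩, h⟩)
    · exact ⟨hact, .inl ⟨hr, early.2 h⟩⟩
    · exact ⟨hact, .inr ⟨hr, fun H => hno ((late hr).1 H), (commit hr).2 h⟩⟩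

/-- All clocks are shifted by the same amount, so skews persist, and delays are inherited from the
wrapped messages. -/
theorem IsExecution.agreementRun (he : IsExecution (broadcast L f Δ σ pick B) f δ e)
    (hT : 0 ≤ 3 * Δ + 2 * σ) :
    IsExecution B f δ (agreementRun L f (3 * Δ + 2 * σ) pick e) where
  byzantine := he.byzantine
  skew p hp q hq := by simpa [SyncBB.agreementRun] using he.skew p hp q hq
  finite_recv p hp S := by
    have hinj : Function.Injective
        (fun a : ℝ × Fin n × M => ((a.1, a.2.1, Msg.ba a.2.2) : ℝ × Fin n × Msg V M)) := by
      rintro ⟨a, b, c⟩ ⟨a', b', c'⟩ hab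
      simpa using hab
    exact (he.finite_recv p hp S).preimage (hinj.injOn (s := _))
  delivery := by
    obtain ⟨delay, hdelay, hrecv⟩ := he.delivery
    refine ⟨fun q p s m => delay q p s (.ba m), fun q p s m => hdelay q p s _,
      fun q hq p hp r m => ?_⟩
    refine (hrecv q hq p hp r (.ba m)).trans (exists_congr fun s => and_congr_left fun _ => ?_)
    exact (sends_agreementRun hT).symm

theorem commitsAt_of_quorum (hΔ : 0 ≤ Δ) (hσ : 0 ≤ σ) (h0 : 0 ≤ t)
    (ht : t ≤ 2 * Δ + σ) (hx : Quorum L (n - f - 1) (e.localHist p) (.ack x) t) :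
    e.CommitsAt (broadcast L f Δ σ pick B) p (e.start p + t) (some x) := by
  refine (commitsAt_broadcast hΔ hσ).2 (.inl ?_)
  rw [add_sub_cancel_left]
  exact ⟨active_broadcast h0 (by linarith), ht, x, rfl, hx⟩

/-- If the broadcaster is honest, then every honest party commits its input at time `2δ` since the
broadcaster starts. -/
theorem IsExecution.commitsAt_input (he : IsExecution (broadcast L f Δ σ pick B) f δ e)
    (hpick : ∀ p S, S.Nonempty → pick p S ∈ S) (hδ : 0 < δ) (hδΔ : δ ≤ Δ) (hδσ : δ ≤ σ)
    (hL : L ∈ e.honest) (hx : e.input L = some x) (hp : p ∈ e.honest) :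
    e.CommitsAt (broadcast L f Δ σ pick B) p (e.start L + 2 * δ) (some x) := by
  have h := abs_le.1 (he.skew L hL p hp)
  have := commitsAt_of_quorum (pick := pick) (B := B) (hδ.le.trans hδΔ)
    (hδ.le.trans hδσ) (by linarith) (by linarith)
    (he.quorum_of_honest hpick hδ hδΔ hδσ hL hx hp)
  rwa [add_sub_cancel] at this

theorem IsExecution.commitsAndTerminates (he : IsExecution (broadcast L f Δ σ pick B) f δ e)
    (hB : SolvesBA B f Δ) (hδ : 0 < δ) (hδΔ : δ ≤ Δ) (hσ : 0 ≤ σ) (hp : p ∈ e.honest) :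
    e.CommitsAndTerminates (broadcast L f Δ σ pick B) p := by
  have hΔ := hδ.le.trans hδΔ
  have hT : 0 ≤ 3 * Δ + 2 * σ := by linarith
  obtain ⟨t, ht, hhalt, r, hr, o, ho⟩ :=
    hB.termination δ _ hδ hδΔ (he.agreementRun (L := L) (pick := pick) hT) p hp
  have hr' : r ≤ e.start p + (t + (3 * Δ + 2 * σ)) := by
    have : r ≤ e.start p + (3 * Δ + 2 * σ) + t := hr
    linarith
  refine ⟨t + (3 * Δ + 2 * σ), by linarith,
    (halt_broadcast hT).2 ⟨by linarith, by rwa [add_sub_cancel_right]⟩, ?_⟩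
  -- A party with an early quorum ignores the output of the agreement, but it still holds the
  -- quorum, and so commits, at the deadline `2Δ + σ`.
  by_cases hq : ∃ y : V, Quorum L (n - f - 1) (e.localHist p) (.ack y) (2 * Δ + σ)
  · obtain ⟨y, hy⟩ := hq
    exact ⟨_, by linarith, _, commitsAt_of_quorum hΔ hσ (by linarith) le_rfl hy⟩
  · exact ⟨r, hr', o, (commitsAt_broadcast hΔ hσ).2 (.inr ⟨hq, ho⟩)⟩

theorem IsExecution.agreement (he : IsExecution (broadcast L f Δ σ pick B) f δ e)
    (hB : SolvesBA B f Δ) (hpick : ∀ p S, S.Nonempty → pick p S ∈ S) (hn : 2 ≤ n)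
    (hnf : 4 * f ≤ n) (hδ : 0 < δ) (hδΔ : δ ≤ Δ) (hδσ : δ ≤ σ) (hb : BroadcastInput L e)
    (hp : p ∈ e.honest) (hq : q ∈ e.honest) {o o' : Option V}
    (ho : e.Commits (broadcast L f Δ σ pick B) p o)
    (ho' : e.Commits (broadcast L f Δ σ pick B) q o') : o = o' := by
  have hΔ := hδ.le.trans hδΔ
  have hσ := hδ.le.trans hδσ
  have hT : 0 ≤ 3 * Δ + 2 * σ := by linarith
  have hx := he.agreementRun (L := L) (pick := pick) hT
  have cases : ∀ p ∈ e.honest, ∀ o, e.Commits (broadcast L f Δ σ pick B) p o →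
      (∃ y, o = some y ∧
        ∀ q ∈ e.honest, lock L f (pick q) (e.localHist q) (3 * Δ + 2 * σ) = some y) ∨
      (SyncBB.agreementRun L f (3 * Δ + 2 * σ) pick e).Commits B p o := by
    rintro p hp o ⟨r, hr⟩
    rcases (commitsAt_broadcast hΔ hσ).1 hr with ⟨-, hle, y, rfl, hy⟩ | ⟨-, h⟩
    · exact .inl ⟨y, rfl, fun q hq =>
        he.lock_eq_of_quorum hpick hn hnf hδ hδΔ hδσ hb hp (hy.mono hle) hq⟩
    · exact .inr ⟨r, h⟩
  -- A common lock `y` makes `y` a commit of the agreement by validity; agreement of `p` with itself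
  -- then leaves no other.
  have mixed : ∀ y, (∀ q ∈ e.honest,
      lock L f (pick q) (e.localHist q) (3 * Δ + 2 * σ) = some y) →
      ∀ p ∈ e.honest, ∀ o, (SyncBB.agreementRun L f (3 * Δ + 2 * σ) pick e).Commits B p o →
        some y = o := fun y hy p hp o ho =>
    hB.agreement δ _ hδ hδΔ hx p hp p hp _ _ (hB.validity δ _ hδ hδΔ hx _ hy p hp) ho
  rcases cases p hp o ho with ⟨y, rfl, hy⟩ | ho <;>
    rcases cases q hq o' ho' with ⟨y', rfl, hy'⟩ | ho'
  · exact (hy p hp).symm.trans (hy' p hp)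
  · exact mixed y hy q hq o' ho'
  · exact (mixed y' hy' p hp o ho).symm
  · exact hB.agreement δ _ hδ hδΔ hx p hp q hq o o' ho ho'

theorem solvesBB_broadcast (hB : SolvesBA B f Δ) (hpick : ∀ p S, S.Nonempty → pick p S ∈ S)
    (hn : 2 ≤ n) (hnf : 4 * f ≤ n) (hσ : Δ ≤ σ) :
    SolvesBB (broadcast L f Δ σ pick B) L f Δ where
  agreement _ _ hδ hδΔ he hb _ hp _ hq _ _ ho ho' :=
    he.agreement hB hpick hn hnf hδ hδΔ (hδΔ.trans hσ) hb hp hq ho ho'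
  validity _ _ hδ hδΔ he _ hL _ hx _ hp :=
    ⟨⟨_, he.commitsAt_input hpick hδ hδΔ (hδΔ.trans hσ) hL hx hp⟩,
      he.commitsAndTerminates hB hδ hδΔ (hδ.le.trans (hδΔ.trans hσ)) hp⟩
  termination _ _ hδ hδΔ he _ _ hp :=
    he.commitsAndTerminates hB hδ hδΔ (hδ.le.trans (hδΔ.trans hσ)) hp

theorem goodCaseLatency_broadcast (hpick : ∀ p S, S.Nonempty → pick p S ∈ S) (hσ : Δ ≤ σ) :
    GoodCaseLatency (broadcast L f Δ σ pick B) L f Δ (fun δ => 2 * δ) := by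
  intro δ e hδ hδΔ he hb hL p hp
  obtain ⟨x, hx⟩ := Option.isSome_iff_exists.1 ((hb L hL).2 rfl)
  exact ⟨_, le_rfl, _, he.commitsAt_input hpick hδ hδΔ (hδΔ.trans hσ) hL hx hp⟩

end Agreement

end SyncBB

theorem theorem9 {V : Type u} [Nontrivial V] (n f : ℕ) (hn : 2 ≤ n) (hnf : 4 * f ≤ n)
    (L : Fin n) (Δ : ℝ) (hΔ : 0 < Δ) :
    -- solves Byzantine broadcast with good-case latency `2δ`
    (∀ (pick : Fin n → Set V → V), (∀ p S, S.Nonempty → pick p S ∈ S) →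
      ∀ (M : Type w) (B : SyncBB.Protocol n (Option V) (Option V) M), SyncBB.SolvesBA B f Δ →
        SyncBB.SolvesBB (SyncBB.broadcast L f Δ Δ pick B) L f Δ ∧
        SyncBB.GoodCaseLatency (SyncBB.broadcast L f Δ Δ pick B) L f Δ (fun δ => 2 * δ)) ∧
    -- `2δ` is optimal
    (1 ≤ f → ∀ (M : Type w) (P : SyncBB.Protocol n (Option V) (Option V) M),
      SyncBB.SolvesBB P L f Δ → ∀ T : ℝ → ℝ, SyncBB.GoodCaseLatency P L f Δ T →
        ∀ δ : ℝ, 0 < δ → δ ≤ Δ → 2 * δ ≤ T δ) ∧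
    -- the resilience is optimal for good-case latency `2δ`
    (∀ (n' : ℕ), 3 ≤ n' → n' < 4 * f →
      ∀ (L' : Fin n') (M : Type w) (P : SyncBB.Protocol n' (Option V) (Option V) M),
        SyncBB.SolvesBB P L' f Δ → ∀ T : ℝ → ℝ, SyncBB.GoodCaseLatency P L' f Δ T →
          ∀ δ : ℝ, 0 < δ → δ ≤ Δ → 2 * δ < T δ) := by
  refine ⟨fun pick hpick M B hB => ⟨SyncBB.solvesBB_broadcast hB hpick hn hnf le_rfl,
    SyncBB.goodCaseLatency_broadcast hpick le_rfl⟩, fun hf M P hP T hT δ hδ hδΔ =>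
    SyncBB.two_mul_le_latency (by omega) hf hP hT hδ hδΔ,
    fun n' hn' hn'f L' M P hP T hT δ hδ hδΔ => ?_⟩
  -- Three parties are too few for the groups `{L}`, `A`, `B`, `D` to be nonempty, so this case
  -- needs its own argument.
  rcases hn'.eq_or_lt with rfl | hn'
  · exact absurd hP (SyncBB.not_solvesBB_three (by omega) hΔ)
  · have := SyncBB.three_mul_le_latency hn' hn'f hP hT hδ hδΔ
    linarith
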